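/- Let $M$ be a smooth $n$-dimensional manifold with a smooth metric $g_{ij}$ (Riemannian or, more generally, of any signature), let $V$ be a smooth real function on $M$, and let $Y=Y^i\partial_i$ be a smooth vector field on $M$ that is a Killing vector (KV, $L_Yg_{ij}=0$) or a homothetic vector (HV, $L_Yg_{ij}=2\psi g_{ij}$ with $\psi$ a real constant) of $g_{ij}$. Consider the Schrödinger equation in the form $$\Delta u-u_{,t}=V(x^k)\,u,\qquad \Delta u=g^{ij}u_{,ij}-g^{jk}\Gamma^i_{jk}u_{,i},\qquad t\in\mathbb R,\ x\in M,$$ for a real function $u(t,x)$, and the classical Lagrangian $L=\tfrac12 g_{ij}\dot x^i\dot x^j-V(x^k)$. Say that $Y$ *produces a Lie point symmetry* of the Schrödinger equation if there are smooth functions $T(t)$, not identically zero, $\xi(t,x,u)$ and $\eta(t,x,u)$ such that $X=\xi\,\partial_t+T(t)Y^i\partial_i+\eta\,\partial_u$ is a Lie point symmetry of the equation, that is, with $H=\Delta u-u_{,t}-Vu$ regarded as a function on the second order jet space and $X^{[2]}$ the second prolongation of $X$, there is a function $\lambda$ on the jet space with $X^{[2]}H=\lambda H$. Say that $Y$ *generates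 a Noether point symmetry* of $L$ if there are smooth functions $T(t)$, not identically zero, $\tau(t,x)$ and $f(t,x)$ such that $\mathbf X=\tau\,\partial_t+T(t)Y^i\partial_i$ satisfies $\mathbf X^{[1]}L+\frac{d\tau}{dt}L=\frac{df}{dt}$ identically in $(t,x,\dot x)$, where $\mathbf X^{[1]}$ is the first prolongation of $\mathbf X$. (The functions $T$ in the two definitions need not be the same.) Then $Y$ produces a Lie point symmetry of the Schrödinger equation if and only if it generates a Noether point symmetry of the Lagrangian $L$. -/

import Mathlib

open scoped Manifold ContDiff

noncomputable section

namespace PointSym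

/-! ### Point transformations of second order scalar PDEs

`ι` indexes the independent variables `z = (zⁱ)`, `u` is the dependent variable,
`p i` stands for `u_{,i}` and `q i j` for `u_{,ij}`. -/

/-- First order jets `(z, u, p)`. -/
abbrev Jet1 (ι : Type) : Type := (ι → ℝ) × ℝ × (ι → ℝ)

/-- Second order jets `(z, u, p, q)`; only those with `q` symmetric are jets of functions. -/
abbrev Jet2 (ι : Type) : Type := (ι → ℝ) × ℝ × (ι → ℝ) × (ι → ι → ℝ)

section PDE

variable {ι : Type} [Fintype ι] [DecidableEq ι]

/-- The total derivative `D_i F = F_{,i} + u_{,i} F_{,u}` of a function `F (z, u)`. -/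
def totalDeriv0 (F : (ι → ℝ) × ℝ → ℝ) (i : ι) (J : Jet1 ι) : ℝ :=
  fderiv ℝ F (J.1, J.2.1) (Pi.single i 1, J.2.2 i)

/-- The total derivative `D_i F = F_{,i} + u_{,i} F_{,u} + ∑ k, u_{,ki} ∂F/∂u_{,k}` of a
function `F (z, u, p)`. -/
def totalDeriv1 (F : Jet1 ι → ℝ) (i : ι) (J : Jet2 ι) : ℝ :=
  fderiv ℝ F (J.1, J.2.1, J.2.2.1) (Pi.single i 1, J.2.2.1 i, fun k => J.2.2.2 k i)

/-- `η_[i] = D_i η - u_{,j} D_i ξʲ`. -/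
def prolongCoeff1 (ξ : ι → (ι → ℝ) × ℝ → ℝ) (η : (ι → ℝ) × ℝ → ℝ) (i : ι) (J : Jet1 ι) : ℝ :=
  totalDeriv0 η i J - ∑ j, J.2.2 j * totalDeriv0 (ξ j) i J

/-- `η_[ij] = D_j η_[i] - u_{,ik} D_j ξᵏ`. -/
def prolongCoeff2 (ξ : ι → (ι → ℝ) × ℝ → ℝ) (η : (ι → ℝ) × ℝ → ℝ) (i j : ι) (J : Jet2 ι) : ℝ :=
  totalDeriv1 (prolongCoeff1 ξ η i) j J
    - ∑ k, J.2.2.2 i k * totalDeriv0 (ξ k) j (J.1, J.2.1, J.2.2.1)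

/-- `X^[2] H`: the derivative of `H` along the second prolongation of
`X = ξⁱ ∂_i + η ∂_u`. -/
def prolong2 (ξ : ι → (ι → ℝ) × ℝ → ℝ) (η : (ι → ℝ) × ℝ → ℝ) (H : Jet2 ι → ℝ)
    (J : Jet2 ι) : ℝ :=
  fderiv ℝ H J
    (fun i => ξ i (J.1, J.2.1), η (J.1, J.2.1),
      fun i => prolongCoeff1 ξ η i (J.1, J.2.1, J.2.2.1), fun i j => prolongCoeff2 ξ η i j J)

/-- `X = ξⁱ(z,u) ∂_i + η(z,u) ∂_u` is smooth over `U` and is a Lie point symmetry over `U` of the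
second order equation `H = 0`: there is a function `μ` on the jet space with `X^[2] H = μ H`. -/
def IsLiePointSymmetryOn (H : Jet2 ι → ℝ) (U : Set (ι → ℝ))
    (ξ : ι → (ι → ℝ) × ℝ → ℝ) (η : (ι → ℝ) × ℝ → ℝ) : Prop :=
  (∀ i, ContDiffOn ℝ ∞ (ξ i) (U ×ˢ Set.univ)) ∧ ContDiffOn ℝ ∞ η (U ×ˢ Set.univ) ∧
    ∃ μ : Jet2 ι → ℝ, ∀ J : Jet2 ι, J.1 ∈ U → (∀ i j, J.2.2.2 i j = J.2.2.2 j i) →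
      prolong2 ξ η H J = μ J * H J

end PDE

/-! ### Noether point symmetries -/

section Noether

variable {n : ℕ}

/-- `dF/dt = F_{,t} + ẋᵏ F_{,k}` for `F (t, x)`, as a function of `(t, x, ẋ)`. -/
def timeDeriv (F : ℝ × (Fin n → ℝ) → ℝ) (t : ℝ) (x v : Fin n → ℝ) : ℝ :=
  fderiv ℝ F (t, x) (1, v)

/-- `X^[1] L` for `X = τ ∂_t + ηⁱ ∂_i` and a Lagrangian `L (t, x, ẋ)`; the coefficient of
`∂/∂ẋⁱ` is `dηⁱ/dt - ẋⁱ dτ/dt`. -/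
def prolongLagrangian (τ : ℝ × (Fin n → ℝ) → ℝ) (η : Fin n → ℝ × (Fin n → ℝ) → ℝ)
    (L : ℝ × (Fin n → ℝ) × (Fin n → ℝ) → ℝ) (t : ℝ) (x v : Fin n → ℝ) : ℝ :=
  fderiv ℝ L (t, x, v)
    (τ (t, x), fun i => η i (t, x), fun i => timeDeriv (η i) t x v - v i * timeDeriv τ t x v)

/-- `X = τ(t,x) ∂_t + ηⁱ(t,x) ∂_i` is smooth over `ℝ × U` and is there a Noether point symmetry of
`L` with gauge function `f`: `X^[1] L + (dτ/dt) L = df/dt`. -/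
def IsNoetherPointSymmetryOn (L : ℝ × (Fin n → ℝ) × (Fin n → ℝ) → ℝ) (U : Set (Fin n → ℝ))
    (τ : ℝ × (Fin n → ℝ) → ℝ) (η : Fin n → ℝ × (Fin n → ℝ) → ℝ)
    (f : ℝ × (Fin n → ℝ) → ℝ) : Prop :=
  ContDiffOn ℝ ∞ τ (Set.univ ×ˢ U) ∧ (∀ i, ContDiffOn ℝ ∞ (η i) (Set.univ ×ˢ U)) ∧
    ContDiffOn ℝ ∞ f (Set.univ ×ˢ U) ∧
    ∀ (t : ℝ) (x v : Fin n → ℝ), x ∈ U →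
      prolongLagrangian τ η L t x v + timeDeriv τ t x v * L (t, x, v) = timeDeriv f t x v

end Noether

/-! ### Metrics in coordinates -/

section Coordinates

variable {n : ℕ}

/-- The partial derivative `F_{,i}`. -/
def pd (F : (Fin n → ℝ) → ℝ) (i : Fin n) (x : Fin n → ℝ) : ℝ :=
  fderiv ℝ F x (Pi.single i 1)

/-- The Christoffel symbols `Γⁱ_{jk}` of the metric `g`. -/
def christoffel (g : (Fin n → ℝ) → Matrix (Fin n) (Fin n) ℝ) (i j k : Fin n)
    (x : Fin n → ℝ) : ℝ :=
  (1 / 2) * ∑ l, (g x)⁻¹ i l *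
    (pd (fun y => g y l j) k x + pd (fun y => g y l k) j x - pd (fun y => g y j k) l x)

/-- `Γⁱ = g^{jk} Γⁱ_{jk}`. -/
def christoffelTrace (g : (Fin n → ℝ) → Matrix (Fin n) (Fin n) ℝ) (i : Fin n)
    (x : Fin n → ℝ) : ℝ :=
  ∑ j, ∑ k, (g x)⁻¹ j k * christoffel g i j k x

/-- The components `(L_Y g)_{ij} = Yᵏ g_{ij,k} + g_{kj} Yᵏ_{,i} + g_{ik} Yᵏ_{,j}`. -/
def lieDerivMetric (g : (Fin n → ℝ) → Matrix (Fin n) (Fin n) ℝ)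
    (Y : Fin n → (Fin n → ℝ) → ℝ) (i j : Fin n) (x : Fin n → ℝ) : ℝ :=
  ∑ k, (Y k x * pd (fun y => g y i j) k x + g x k j * pd (Y k) i x + g x i k * pd (Y k) j x)

/-- The function `g^{ij} u_{,ij} - Γⁱ u_{,i} - u_{,t} - V u` on the second order jets in the
independent variables `(t, x)`, so that its zero set is the Schrödinger equation
`Δ u - u_{,t} = V u`. The index `none` stands for `t` and `some i` for `xⁱ`. -/
def schrodinger (g : (Fin n → ℝ) → Matrix (Fin n) (Fin n) ℝ) (V : (Fin n → ℝ) → ℝ)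
    (J : Jet2 (Option (Fin n))) : ℝ :=
  (∑ i, ∑ j, (g fun k => J.1 (some k))⁻¹ i j * J.2.2.2 (some i) (some j))
    - (∑ i, christoffelTrace g i (fun k => J.1 (some k)) * J.2.2.1 (some i))
    - J.2.2.1 none - V (fun k => J.1 (some k)) * J.2.1

/-- The Lagrangian `L = ½ g_{ij} ẋⁱ ẋʲ - V`. -/
def lagrangian (g : (Fin n → ℝ) → Matrix (Fin n) (Fin n) ℝ) (V : (Fin n → ℝ) → ℝ)
    (w : ℝ × (Fin n → ℝ) × (Fin n → ℝ)) : ℝ :=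
  (1 / 2) * (∑ i, ∑ j, g w.2.1 i j * w.2.2 i * w.2.2 j) - V w.2.1

end Coordinates

/-! ### Smooth manifolds -/

section Manifold

variable {n : ℕ} {M : Type*} [TopologicalSpace M] [ChartedSpace (EuclideanSpace ℝ (Fin n)) M]

/-- The range of the coordinates of a chart `e`, as a subset of `Fin n → ℝ`. -/
def coordRange (e : OpenPartialHomeomorph M (EuclideanSpace ℝ (Fin n))) : Set (Fin n → ℝ) :=
  {x | WithLp.toLp 2 x ∈ e.target}

/-- The point of `M` with coordinates `x` in the chart `e`. -/
def coordPoint (e : OpenPartialHomeomorph M (EuclideanSpace ℝ (Fin n))) (x : Fin n → ℝ) : M :=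
  e.symm (WithLp.toLp 2 x)

/-- The `i`-th component of the tangent vector `v` at `coordPoint e x` in the chart `e`. -/
def coordComp (e : OpenPartialHomeomorph M (EuclideanSpace ℝ (Fin n))) (x : Fin n → ℝ)
    (v : TangentSpace (𝓡 n) (coordPoint e x)) (i : Fin n) : ℝ :=
  (show EuclideanSpace ℝ (Fin n) from mfderiv (𝓡 n) (𝓡 n) e (coordPoint e x) v) i

/-- The coordinate vector `∂_i` of the chart `e` at the point with coordinates `x`. -/
def coordVec (e : OpenPartialHomeomorph M (EuclideanSpace ℝ (Fin n))) (x : Fin n → ℝ)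
    (i : Fin n) : TangentSpace (𝓡 n) (coordPoint e x) :=
  mfderiv (𝓡 n) (𝓡 n) e.symm (WithLp.toLp 2 x)
    (show TangentSpace (𝓡 n) (WithLp.toLp 2 x : EuclideanSpace ℝ (Fin n)) from
      EuclideanSpace.single i (1 : ℝ))

variable (n M) in
/-- A smooth metric of arbitrary signature (in particular, a Riemannian metric) on `M`. -/
structure Metric where
  /-- the bilinear form on each tangent space -/
  val : ∀ x : M, TangentSpace (𝓡 n) x →ₗ[ℝ] TangentSpace (𝓡 n) x →ₗ[ℝ] ℝ
  symm : ∀ (x : M) (v w : TangentSpace (𝓡 n) x), val x v w = val x w v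
  nondegenerate : ∀ (x : M) (v : TangentSpace (𝓡 n) x), (∀ w, val x v w = 0) → v = 0
  smooth : ∀ e ∈ IsManifold.maximalAtlas (𝓡 n) ∞ M, ∀ i j : Fin n,
    ContDiffOn ℝ ∞
      (fun x : Fin n → ℝ => val (coordPoint e x) (coordVec e x i) (coordVec e x j)) (coordRange e)

/-- The components `g_{ij}` of the metric in the chart `e`. -/
def Metric.comp (g : Metric n M) (e : OpenPartialHomeomorph M (EuclideanSpace ℝ (Fin n)))
    (x : Fin n → ℝ) : Matrix (Fin n) (Fin n) ℝ :=
  Matrix.of fun i j => g.val (coordPoint e x) (coordVec e x i) (coordVec e x j)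

/-- `Y` is a homothetic vector field of `g` with constant factor `ψ`, that is `L_Y g = 2 ψ g`. -/
def HasHomotheticFactor (g : Metric n M) (Y : ∀ x : M, TangentSpace (𝓡 n) x) (ψ : ℝ) : Prop :=
  ∀ e ∈ IsManifold.maximalAtlas (𝓡 n) ∞ M, ∀ x ∈ coordRange e, ∀ i j : Fin n,
    lieDerivMetric (g.comp e) (fun k y => coordComp e y (Y (coordPoint e y)) k) i j x
      = 2 * ψ * g.comp e x i j

/-- `Y` is a Killing vector field (KV) of `g`. -/
def IsKilling (g : Metric n M) (Y : ∀ x : M, TangentSpace (𝓡 n) x) : Prop :=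
  HasHomotheticFactor g Y 0

/-- `Y` is a homothetic vector field (HV) of `g`. -/
def IsHomothetic (g : Metric n M) (Y : ∀ x : M, TangentSpace (𝓡 n) x) : Prop :=
  ∃ ψ : ℝ, HasHomotheticFactor g Y ψ

/-- The vector field `X = ξ ∂_t + Ξ + η ∂_u` on `ℝ × M × ℝ ∋ (t, x, u)`, with `Ξ` tangent to `M`,
is smooth and is a Lie point symmetry of the Schrödinger equation `Δ u - u_{,t} = V u` on
`ℝ × M`: this holds in the coordinates of each chart of `M`. -/
def IsLiePointSymmetry (g : Metric n M) (V : M → ℝ) (ξ : ℝ × M × ℝ → ℝ)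
    (Ξ : ∀ w : ℝ × M × ℝ, TangentSpace (𝓡 n) w.2.1) (η : ℝ × M × ℝ → ℝ) : Prop :=
  ∀ e ∈ IsManifold.maximalAtlas (𝓡 n) ∞ M,
    IsLiePointSymmetryOn (ι := Option (Fin n))
      (schrodinger (g.comp e) fun x => V (coordPoint e x))
      {z | (fun i => z (some i)) ∈ coordRange e}
      (fun a w => a.elim
        (ξ (w.1 none, coordPoint e (fun i => w.1 (some i)), w.2))
        (coordComp e (fun i => w.1 (some i))
          (Ξ (w.1 none, coordPoint e (fun i => w.1 (some i)), w.2))))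
      (fun w => η (w.1 none, coordPoint e (fun i => w.1 (some i)), w.2))

/-- The vector field `X = τ ∂_t + Ξ` on `ℝ × M ∋ (t, x)`, with `Ξ` tangent to `M`, is smooth and is
a Noether point symmetry of the Lagrangian `½ g_{ij} ẋⁱ ẋʲ - V` on `M`, with some smooth gauge
function `f (t, x)`: the Noether condition holds in the coordinates of each chart of `M`. -/
def IsNoetherPointSymmetry (g : Metric n M) (V : M → ℝ) (τ : ℝ × M → ℝ)
    (Ξ : ∀ w : ℝ × M, TangentSpace (𝓡 n) w.2) : Prop :=
  ∃ f : ℝ × M → ℝ, ∀ e ∈ IsManifold.maximalAtlas (𝓡 n) ∞ M,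
    IsNoetherPointSymmetryOn
      (lagrangian (g.comp e) fun x => V (coordPoint e x)) (coordRange e)
      (fun w => τ (w.1, coordPoint e w.2))
      (fun i w => coordComp e w.2 (Ξ (w.1, coordPoint e w.2)) i)
      (fun w => f (w.1, coordPoint e w.2))

/-- The vector field `Y` of `M` produces a Lie point symmetry of the Schrödinger equation: some Lie
point symmetry has the form `ξ ∂_t + T(t) Yⁱ ∂_i + η ∂_u` with `T` not identically zero. -/
def ProducesLiePointSymmetry (g : Metric n M) (V : M → ℝ)
    (Y : ∀ x : M, TangentSpace (𝓡 n) x) : Prop :=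
  ∃ T : ℝ → ℝ, ContDiff ℝ ∞ T ∧ (∃ t, T t ≠ 0) ∧
    ∃ ξ η : ℝ × M × ℝ → ℝ, IsLiePointSymmetry g V ξ (fun w => T w.1 • Y w.2.1) η

/-- The vector field `Y` of `M` generates a Noether point symmetry of the Lagrangian
`½ g_{ij} ẋⁱ ẋʲ - V`: some Noether point symmetry has the form `τ ∂_t + T(t) Yⁱ ∂_i` with `T` not
identically zero. -/
def GeneratesNoetherPointSymmetry (g : Metric n M) (V : M → ℝ)
    (Y : ∀ x : M, TangentSpace (𝓡 n) x) : Prop :=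
  ∃ T : ℝ → ℝ, ContDiff ℝ ∞ T ∧ (∃ t, T t ≠ 0) ∧
    ∃ τ : ℝ × M → ℝ, IsNoetherPointSymmetry g V τ (fun w => T w.1 • Y w.2)

end Manifold

end PointSym

end

/-!
Let `W = Y(V) + 2 ψ V`, and let `Y♭` be the one-form dual to `Y`. Both conditions are equivalent to
`dW = c Y♭` for some constant `c`.

For a Lie symmetry, evaluate the symmetry condition on jets with vanishing `u_{,t}` and `u_{,ti}`
and with `u_{,ij}` proportional to `g_{ij}`. There `ξ` drops out, and what remains says that
`η = A u + B` with `∂_i A = -½ T' Y_i` and `∂_t A = -T W - ½ n ψ T'`. Equality of mixed derivatives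
of `A` gives `T ∂_i W = ½ T'' Y_i`. For a Noether symmetry the condition is a cubic polynomial in
the velocities. Its coefficients give `∂_i f = T' Y_i` and `∂_t f = -T W`, hence
`T ∂_i W = -T'' Y_i`.

Conversely, if `dW = c Y♭`, choose `α` with `α'' = k α` and `α' ≠ 0` somewhere, where `k = 2 c` in
the Lie case and `k = -c` in the Noether case. Then `T = -α'` and `ξ = τ = -2 ψ α` define
symmetries, with `A = α W + ½ n ψ α'` and `f = α W` respectively.
-/

noncomputable section

namespace PointSym

section Calculus

theorem fderiv_congr_of_eqOn {E : Type*} [AddCommGroup E] [Module ℝ E] [TopologicalSpace E]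
    {U : Set E} {F G : E → ℝ} {w : E} (hU : IsOpen U) (h : Set.EqOn F G U) (hw : w ∈ U) :
    fderiv ℝ F w = fderiv ℝ G w :=
  Filter.EventuallyEq.fderiv_eq (Filter.eventuallyEq_of_mem (hU.mem_nhds hw) h)

variable {E : Type*} [NormedAddCommGroup E] [NormedSpace ℝ E] {U : Set E} {w : E}

theorem contDiffOn_fderiv_apply {F : E → ℝ} (hU : IsOpen U) (hF : ContDiffOn ℝ ∞ F U) (v : E) :
    ContDiffOn ℝ ∞ (fun w => fderiv ℝ F w v) U :=
  (hF.fderiv_of_isOpen hU (m := ∞) (by simp)).clm_apply contDiffOn_const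

theorem differentiableAt_of_contDiffOn {F : E → ℝ} (hU : IsOpen U) (hF : ContDiffOn ℝ ∞ F U)
    (hw : w ∈ U) : DifferentiableAt ℝ F w :=
  (hF.contDiffAt (hU.mem_nhds hw)).differentiableAt (by simp)

theorem differentiableAt_fderiv_of_contDiffOn {F : E → ℝ} (hU : IsOpen U)
    (hF : ContDiffOn ℝ ∞ F U) (hw : w ∈ U) : DifferentiableAt ℝ (fderiv ℝ F) w :=
  ((hF.fderiv_of_isOpen hU (m := ∞) (by simp)).contDiffAt (hU.mem_nhds hw)).differentiableAt
    (by simp)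

theorem fderiv_fderiv_apply {F : E → ℝ} (hU : IsOpen U) (hF : ContDiffOn ℝ ∞ F U) (hw : w ∈ U)
    (v d : E) : fderiv ℝ (fun y => fderiv ℝ F y v) w d = fderiv ℝ (fderiv ℝ F) w d v := by
  rw [((differentiableAt_fderiv_of_contDiffOn hU hF hw).hasFDerivAt.clm_apply
    (hasFDerivAt_const v w)).fderiv]
  simp

theorem fderiv_fderiv_symm {F : E → ℝ} (hU : IsOpen U) (hF : ContDiffOn ℝ ∞ F U) (hw : w ∈ U)
    (v d : E) : fderiv ℝ (fderiv ℝ F) w d v = fderiv ℝ (fderiv ℝ F) w v d :=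
  (hF.contDiffAt (hU.mem_nhds hw)).isSymmSndFDerivAt
    (by simpa using WithTop.coe_le_coe.2 (le_top : (2 : ℕ∞) ≤ ⊤)) d v

theorem fderiv_comm_of_eqOn {F P Q : E → ℝ} (hU : IsOpen U) (hF : ContDiffOn ℝ ∞ F U) {v d : E}
    (hP : ∀ y ∈ U, fderiv ℝ F y v = P y) (hQ : ∀ y ∈ U, fderiv ℝ F y d = Q y) (hw : w ∈ U) :
    fderiv ℝ P w d = fderiv ℝ Q w v := by
  rw [← fderiv_congr_of_eqOn hU hP hw, ← fderiv_congr_of_eqOn hU hQ hw,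
    fderiv_fderiv_apply hU hF hw, fderiv_fderiv_apply hU hF hw, fderiv_fderiv_symm hU hF hw]

theorem fderiv_mul_apply {F G : E → ℝ} (hF : DifferentiableAt ℝ F w)
    (hG : DifferentiableAt ℝ G w) (v : E) :
    fderiv ℝ (fun y => F y * G y) w v = F w * fderiv ℝ G w v + G w * fderiv ℝ F w v := by
  rw [fderiv_fun_mul hF hG]
  simp

theorem fderiv_sum_apply {κ : Type*} [Fintype κ] {F : κ → E → ℝ}
    (hF : ∀ k, DifferentiableAt ℝ (F k) w) (v : E) :
    fderiv ℝ (fun y => ∑ k, F k y) w v = ∑ k, fderiv ℝ (F k) w v := by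
  rw [fderiv_fun_sum fun k _ => hF k]
  simp

theorem fderiv_prodMk_apply {E' : Type*} [NormedAddCommGroup E'] [NormedSpace ℝ E']
    {F : E × E' → ℝ} {w' : E'} (hF : DifferentiableAt ℝ F (w, w')) (d : E × E') :
    fderiv ℝ F (w, w') d
      = fderiv ℝ (fun y => F (y, w')) w d.1 + fderiv ℝ (fun y' => F (w, y')) w' d.2 := by
  have h_fst : HasFDerivAt (fun y => F (y, w')) _ w :=
    hF.hasFDerivAt.comp w (hasFDerivAt_prodMk_left w w')
  have h_snd : HasFDerivAt (fun y' => F (w, y')) _ w' :=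
    hF.hasFDerivAt.comp w' (hasFDerivAt_prodMk_right w w')
  rw [h_fst.fderiv, h_snd.fderiv, ContinuousLinearMap.comp_apply, ContinuousLinearMap.comp_apply,
    ← map_add]
  simp

end Calculus

section MatrixCalculus

variable {E : Type*} [NormedAddCommGroup E] [NormedSpace ℝ E] {U : Set E} {x : E}
  {m : Type*} [Fintype m]

/-- The entrywise derivative at `x` of a matrix valued function in the direction `v`. -/
def matrixDeriv (A : E → Matrix m m ℝ) (x v : E) : Matrix m m ℝ :=
  Matrix.of fun i j => fderiv ℝ (fun y => A y i j) x v

theorem matrixDeriv_mul {A B : E → Matrix m m ℝ}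
    (hA : ∀ i j, DifferentiableAt ℝ (fun y => A y i j) x)
    (hB : ∀ i j, DifferentiableAt ℝ (fun y => B y i j) x) (v : E) :
    matrixDeriv (fun y => A y * B y) x v = A x * matrixDeriv B x v + matrixDeriv A x v * B x := by
  ext i j
  simp only [matrixDeriv, Matrix.of_apply, Matrix.mul_apply, Matrix.add_apply]
  rw [fderiv_sum_apply fun k => (hA i k).fun_mul (hB k j), ← Finset.sum_add_distrib]
  refine Finset.sum_congr rfl fun k _ => ?_
  rw [fderiv_mul_apply (hA i k) (hB k j), mul_comm (B x k j)]

theorem fderiv_trace_apply {A : E → Matrix m m ℝ}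
    (hA : ∀ i j, DifferentiableAt ℝ (fun y => A y i j) x) (v : E) :
    fderiv ℝ (fun y => (A y).trace) x v = (matrixDeriv A x v).trace :=
  fderiv_sum_apply (fun i => hA i i) v

theorem fderiv_dotProduct_apply {a b : E → m → ℝ}
    (ha : ∀ i, DifferentiableAt ℝ (fun y => a y i) x)
    (hb : ∀ i, DifferentiableAt ℝ (fun y => b y i) x) (v : E) :
    fderiv ℝ (fun y => a y ⬝ᵥ b y) x v = a x ⬝ᵥ (fun i => fderiv ℝ (fun y => b y i) x v)
      + (fun i => fderiv ℝ (fun y => a y i) x v) ⬝ᵥ b x := by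
  simp only [dotProduct]
  rw [fderiv_sum_apply fun i => (ha i).fun_mul (hb i), ← Finset.sum_add_distrib]
  refine Finset.sum_congr rfl fun i _ => ?_
  rw [fderiv_mul_apply (ha i) (hb i), mul_comm (b x i)]

theorem fderiv_mulVec_apply {A : E → Matrix m m ℝ} {b : E → m → ℝ}
    (hA : ∀ i j, DifferentiableAt ℝ (fun y => A y i j) x)
    (hb : ∀ i, DifferentiableAt ℝ (fun y => b y i) x) (v : E) (i : m) :
    fderiv ℝ (fun y => (A y).mulVec (b y) i) x v
      = (A x).mulVec (fun j => fderiv ℝ (fun y => b y j) x v) i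
        + (matrixDeriv A x v).mulVec (b x) i :=
  fderiv_dotProduct_apply (hA i) hb v

theorem differentiableAt_dotProduct_mulVec {A : E → Matrix m m ℝ} {b : E → m → ℝ}
    (hA : ∀ i j, DifferentiableAt ℝ (fun y => A y i j) x)
    (hb : ∀ i, DifferentiableAt ℝ (fun y => b y i) x) :
    DifferentiableAt ℝ (fun y => b y ⬝ᵥ (A y).mulVec (b y)) x :=
  DifferentiableAt.fun_sum fun i _ =>
    (hb i).mul (DifferentiableAt.fun_sum fun j _ => (hA i j).mul (hb j))

theorem fderiv_dotProduct_mulVec_apply {A : E → Matrix m m ℝ} {b : E → m → ℝ}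
    (hA : ∀ i j, DifferentiableAt ℝ (fun y => A y i j) x)
    (hb : ∀ i, DifferentiableAt ℝ (fun y => b y i) x) (h_symm : (A x).IsSymm) (v : E) :
    fderiv ℝ (fun y => b y ⬝ᵥ (A y).mulVec (b y)) x v
      = 2 * (b x ⬝ᵥ (A x).mulVec fun i => fderiv ℝ (fun y => b y i) x v)
        + b x ⬝ᵥ (matrixDeriv A x v).mulVec (b x) := by
  have h_swap : (fun i => fderiv ℝ (fun y => b y i) x v) ⬝ᵥ (A x).mulVec (b x)
      = b x ⬝ᵥ (A x).mulVec fun i => fderiv ℝ (fun y => b y i) x v := by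
    rw [Matrix.dotProduct_mulVec, ← Matrix.mulVec_transpose, h_symm.eq, dotProduct_comm]
  have h_mulVec : ∀ i, DifferentiableAt ℝ (fun y => (A y).mulVec (b y) i) x := fun i =>
    DifferentiableAt.fun_sum fun j _ => (hA i j).mul (hb j)
  rw [fderiv_dotProduct_apply hb h_mulVec, h_swap, funext (fderiv_mulVec_apply hA hb v),
    ← Pi.add_def, dotProduct_add]
  ring

variable [DecidableEq m]

theorem contDiffOn_det {A : E → Matrix m m ℝ} (hA : ∀ i j, ContDiffOn ℝ ∞ (fun x => A x i j) U) :
    ContDiffOn ℝ ∞ (fun x => (A x).det) U := by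
  simp only [Matrix.det_apply']
  exact ContDiffOn.sum fun σ _ => contDiffOn_const.mul (contDiffOn_prod fun k _ => hA _ _)

theorem contDiffOn_inv_apply {A : E → Matrix m m ℝ}
    (hA : ∀ i j, ContDiffOn ℝ ∞ (fun x => A x i j) U) (hdet : ∀ x ∈ U, IsUnit (A x).det)
    (i j : m) : ContDiffOn ℝ ∞ (fun x => (A x)⁻¹ i j) U := by
  simp only [Matrix.inv_def, Matrix.smul_apply, smul_eq_mul, Ring.inverse_eq_inv',
    Matrix.adjugate_apply]
  refine ((contDiffOn_det hA).inv fun x hx => (hdet x hx).ne_zero).mul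
    (contDiffOn_det fun k l => ?_)
  by_cases hk : k = j
  · simpa only [Matrix.updateRow_apply, hk, if_true] using contDiffOn_const
  · simpa only [Matrix.updateRow_apply, hk, if_false] using hA k l

theorem matrixDeriv_inv {A : E → Matrix m m ℝ} (hU : IsOpen U)
    (hA : ∀ i j, ContDiffOn ℝ ∞ (fun x => A x i j) U) (hdet : ∀ x ∈ U, IsUnit (A x).det)
    (hx : x ∈ U) (v : E) :
    matrixDeriv (fun y => (A y)⁻¹) x v = -((A x)⁻¹ * matrixDeriv A x v * (A x)⁻¹) := by
  have h_one : matrixDeriv (fun y => (A y)⁻¹ * A y) x v = 0 := by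
    ext i j
    have : Set.EqOn (fun y => ((A y)⁻¹ * A y) i j) (fun _ => (1 : Matrix m m ℝ) i j) U :=
      fun y hy => by simp only [Matrix.nonsing_inv_mul _ (hdet y hy)]
    simp [matrixDeriv, fderiv_congr_of_eqOn hU this hx]
  rw [matrixDeriv_mul
    (fun i j => differentiableAt_of_contDiffOn hU (contDiffOn_inv_apply hA hdet i j) hx)
    (fun i j => differentiableAt_of_contDiffOn hU (hA i j) hx)] at h_one
  rw [← Matrix.neg_mul, ← eq_neg_of_add_eq_zero_right h_one, Matrix.mul_assoc,
    Matrix.mul_nonsing_inv _ (hdet x hx), Matrix.mul_one]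

end MatrixCalculus

section CubicPolynomials

variable {E : Type*} [AddCommGroup E] [Module ℝ E] {B : LinearMap.BilinForm ℝ E}
  {ℓ m : E →ₗ[ℝ] ℝ} {a c : ℝ}

theorem scalar_eq_zero_of_forall_cubic_eq_zero {a₀ a₁ a₂ a₃ : ℝ}
    (h : ∀ s : ℝ, a₃ * s ^ 3 + a₂ * s ^ 2 + a₁ * s + a₀ = 0) :
    a₃ = 0 ∧ a₂ = 0 ∧ a₁ = 0 ∧ a₀ = 0 := by
  have h₀ := h 0
  have h_fst := h 1
  have h_snd := h (-1)
  have h₃ := h 2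
  refine ⟨?_, ?_, ?_, ?_⟩ <;> linarith

theorem homogeneous_parts_eq_zero (h : ∀ v, (ℓ v + a) * B v v + m v + c = 0) (v : E) :
    ℓ v * B v v = 0 ∧ a * B v v = 0 ∧ m v = 0 ∧ c = 0 :=
  scalar_eq_zero_of_forall_cubic_eq_zero fun s => by
    have := h (s • v)
    simp only [map_smul, LinearMap.smul_apply, smul_eq_mul] at this
    linear_combination this

theorem linear_eq_zero_of_forall_mul_quadratic_eq_zero {v₀ : E} (hv₀ : B v₀ v₀ ≠ 0)
    (h : ∀ v, ℓ v * B v v = 0) : ℓ = 0 := by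
  have hℓ₀ : ℓ v₀ = 0 := (mul_eq_zero.1 (h v₀)).resolve_right hv₀
  ext w
  by_contra hw
  have hq : ∀ s : ℝ, s ≠ 0 → B (v₀ + s • w) (v₀ + s • w) = 0 := fun s hs => by
    refine (mul_eq_zero.1 (h (v₀ + s • w))).resolve_left ?_
    simpa [hℓ₀, hs] using hw
  simp only [map_add, map_smul, LinearMap.add_apply, LinearMap.smul_apply, smul_eq_mul] at hq
  have h_fst := hq 1 one_ne_zero
  have h_snd := hq (-1) (by norm_num)
  have h₃ := hq 2 two_ne_zero
  exact hv₀ (by linarith)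

theorem coeffs_eq_zero_of_forall_cubic_eq_zero (hB : B ≠ 0) (hs : B.IsSymm)
    (h : ∀ v, (ℓ v + a) * B v v + m v + c = 0) : ℓ = 0 ∧ a = 0 ∧ m = 0 ∧ c = 0 := by
  obtain ⟨v₀, hv₀⟩ := LinearMap.BilinForm.exists_bilinForm_self_ne_zero hB
    (LinearMap.BilinForm.isSymm_iff.1 hs)
  have hp := homogeneous_parts_eq_zero h
  exact ⟨linear_eq_zero_of_forall_mul_quadratic_eq_zero hv₀ fun v => (hp v).1,
    (mul_eq_zero.1 (hp v₀).2.1).resolve_right hv₀, LinearMap.ext fun v => (hp v).2.2.1,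
    (hp v₀).2.2.2⟩

theorem coeffs_eq_zero_of_forall_cubic_dotProduct_eq_zero {n : Type*} [Fintype n] [DecidableEq n]
    [Nonempty n] {M : Matrix n n ℝ} (hM : M.IsSymm) (hdet : IsUnit M.det) {l m : n → ℝ} {a c : ℝ}
    (h : ∀ v : n → ℝ, (l ⬝ᵥ v + a) * (v ⬝ᵥ M.mulVec v) + m ⬝ᵥ v + c = 0) :
    l = 0 ∧ a = 0 ∧ m = 0 ∧ c = 0 := by
  have hB : Matrix.toBilin' M ≠ 0 := fun h_zero => by
    rw [LinearEquiv.map_eq_zero_iff] at h_zero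
    rw [h_zero, Matrix.det_zero] at hdet
    exact not_isUnit_zero hdet
  have := coeffs_eq_zero_of_forall_cubic_eq_zero hB (Matrix.isSymm_toBilin'_iff_isSymm.2 hM)
    (ℓ := dotProductBilin ℝ ℝ l) (m := dotProductBilin ℝ ℝ m) (a := a) (c := c)
    fun v => by simpa [Matrix.toBilin'_apply'] using h v
  refine ⟨?_, this.2.1, ?_, this.2.2.2⟩
  · exact dotProduct_eq _ _ fun v => by simpa using LinearMap.congr_fun this.1 v
  · exact dotProduct_eq _ _ fun v => by simpa using LinearMap.congr_fun this.2.2.1 v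

end CubicPolynomials

section Metrics

variable {n : ℕ} {g : (Fin n → ℝ) → Matrix (Fin n) (Fin n) ℝ} {Y : Fin n → (Fin n → ℝ) → ℝ}
  {ψ : ℝ} {U : Set (Fin n → ℝ)} {x : Fin n → ℝ}

theorem fderiv_eq_sum_pd (F : (Fin n → ℝ) → ℝ) (x v : Fin n → ℝ) :
    fderiv ℝ F x v = ∑ k, v k * pd F k x := by
  conv_lhs => rw [pi_eq_sum_univ' v]
  simp [pd, map_sum]

theorem contDiffOn_pd {F : (Fin n → ℝ) → ℝ} (hU : IsOpen U) (hF : ContDiffOn ℝ ∞ F U)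
    (i : Fin n) : ContDiffOn ℝ ∞ (pd F i) U :=
  contDiffOn_fderiv_apply hU hF _

theorem pd_comm {F : (Fin n → ℝ) → ℝ} (hU : IsOpen U) (hF : ContDiffOn ℝ ∞ F U) (hx : x ∈ U)
    (i j : Fin n) : pd (pd F i) j x = pd (pd F j) i x :=
  fderiv_comm_of_eqOn hU hF (fun _ _ => rfl) (fun _ _ => rfl) hx

/-- The matrix `∂Yⁱ/∂xʲ` of partial derivatives of the components of a vector field. -/
def jacobian (Y : Fin n → (Fin n → ℝ) → ℝ) (x : Fin n → ℝ) : Matrix (Fin n) (Fin n) ℝ :=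
  Matrix.of fun i j => pd (Y i) j x

/-- The matrix of second partial derivatives of `F`. -/
def hessian (F : (Fin n → ℝ) → ℝ) (x : Fin n → ℝ) : Matrix (Fin n) (Fin n) ℝ :=
  Matrix.of fun i j => pd (pd F i) j x

theorem hessian_isSymm {F : (Fin n → ℝ) → ℝ} (hU : IsOpen U) (hF : ContDiffOn ℝ ∞ F U)
    (hx : x ∈ U) : (hessian F x).IsSymm :=
  Matrix.IsSymm.ext fun i j => pd_comm hU hF hx j i

/-- The components `Y_i = g_{ij} Yʲ` of the one-form dual to a vector field. -/
def lowered (g : (Fin n → ℝ) → Matrix (Fin n) (Fin n) ℝ) (Y : Fin n → (Fin n → ℝ) → ℝ)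
    (i : Fin n) (x : Fin n → ℝ) : ℝ := (g x).mulVec (fun k => Y k x) i

/-- The Christoffel symbols `Γ_{l,jk}` of the first kind, as a matrix in `j` and `k`. -/
def christoffelFirst (g : (Fin n → ℝ) → Matrix (Fin n) (Fin n) ℝ) (l : Fin n)
    (x : Fin n → ℝ) : Matrix (Fin n) (Fin n) ℝ :=
  Matrix.of fun j k => (1 / 2) *
    (pd (fun y => g y l j) k x + pd (fun y => g y l k) j x - pd (fun y => g y j k) l x)

/-- The contraction `g^{jk} Γ_{l,jk}`, as a vector in `l`. -/
def christoffelFirstTrace (g : (Fin n → ℝ) → Matrix (Fin n) (Fin n) ℝ) (x : Fin n → ℝ)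
    (l : Fin n) : ℝ := ((g x)⁻¹ * christoffelFirst g l x).trace

/-- The functions `g i j` are the components of a smooth metric on the open set `U`. -/
structure IsMetricOn (g : (Fin n → ℝ) → Matrix (Fin n) (Fin n) ℝ) (U : Set (Fin n → ℝ)) :
    Prop where
  isOpen : IsOpen U
  smooth : ∀ i j, ContDiffOn ℝ ∞ (fun x => g x i j) U
  isSymm : ∀ x ∈ U, (g x).IsSymm
  isUnit_det : ∀ x ∈ U, IsUnit (g x).det

/-- The `Y i` are the components of a smooth vector field on `U` with `L_Y g = 2 ψ g` there. -/
structure IsHomotheticOn (g : (Fin n → ℝ) → Matrix (Fin n) (Fin n) ℝ)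
    (Y : Fin n → (Fin n → ℝ) → ℝ) (ψ : ℝ) (U : Set (Fin n → ℝ)) : Prop
    extends IsMetricOn g U where
  smooth_field : ∀ i, ContDiffOn ℝ ∞ (Y i) U
  lieDeriv : ∀ x ∈ U, ∀ i j, lieDerivMetric g Y i j x = 2 * ψ * g x i j

namespace IsMetricOn

theorem smooth_inv (h : IsMetricOn g U) (i j : Fin n) :
    ContDiffOn ℝ ∞ (fun x => (g x)⁻¹ i j) U :=
  contDiffOn_inv_apply h.smooth h.isUnit_det i j

theorem differentiableAt (h : IsMetricOn g U) (hx : x ∈ U) (i j : Fin n) :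
    DifferentiableAt ℝ (fun y => g y i j) x :=
  differentiableAt_of_contDiffOn h.isOpen (h.smooth i j) hx

theorem differentiableAt_pd (h : IsMetricOn g U) (hx : x ∈ U) (i j k : Fin n) :
    DifferentiableAt ℝ (pd (fun y => g y i j) k) x :=
  differentiableAt_of_contDiffOn h.isOpen (contDiffOn_pd h.isOpen (h.smooth i j) k) hx

theorem differentiableAt_inv (h : IsMetricOn g U) (hx : x ∈ U) (i j : Fin n) :
    DifferentiableAt ℝ (fun y => (g y)⁻¹ i j) x :=
  differentiableAt_of_contDiffOn h.isOpen (h.smooth_inv i j) hx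

theorem inv_isSymm (h : IsMetricOn g U) (hx : x ∈ U) : ((g x)⁻¹).IsSymm :=
  (h.isSymm x hx).inv

theorem inv_mulVec_lowered (h : IsMetricOn g U) (hx : x ∈ U) :
    ((g x)⁻¹).mulVec (fun i => lowered g Y i x) = fun k => Y k x := by
  change ((g x)⁻¹).mulVec ((g x).mulVec fun k => Y k x) = _
  rw [Matrix.mulVec_mulVec, Matrix.nonsing_inv_mul _ (h.isUnit_det x hx), Matrix.one_mulVec]

theorem lowered_dotProduct_inv_mulVec (h : IsMetricOn g U) (hx : x ∈ U) (p : Fin n → ℝ) :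
    (fun i => lowered g Y i x) ⬝ᵥ (g x)⁻¹.mulVec p = p ⬝ᵥ fun k => Y k x := by
  rw [Matrix.dotProduct_mulVec, ← Matrix.mulVec_transpose, (h.inv_isSymm hx).eq,
    h.inv_mulVec_lowered hx, dotProduct_comm]

theorem pd_symm (h : IsMetricOn g U) (hx : x ∈ U) (i j k : Fin n) :
    pd (fun y => g y i j) k x = pd (fun y => g y j i) k x := by
  rw [pd, fderiv_congr_of_eqOn h.isOpen (fun y hy => (h.isSymm y hy).apply j i) hx, pd]

theorem christoffelFirst_isSymm (h : IsMetricOn g U) (hx : x ∈ U) (l : Fin n) :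
    (christoffelFirst g l x).IsSymm := by
  ext j k
  simp only [Matrix.transpose_apply, christoffelFirst, Matrix.of_apply, h.pd_symm hx k j]
  ring

theorem smooth_christoffelFirst (h : IsMetricOn g U) (l j k : Fin n) :
    ContDiffOn ℝ ∞ (fun x => christoffelFirst g l x j k) U :=
  contDiffOn_const.mul (((contDiffOn_pd h.isOpen (h.smooth _ _) _).add
    (contDiffOn_pd h.isOpen (h.smooth _ _) _)).sub (contDiffOn_pd h.isOpen (h.smooth _ _) _))

theorem differentiableAt_christoffelFirst (h : IsMetricOn g U) (hx : x ∈ U) (l j k : Fin n) :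
    DifferentiableAt ℝ (fun y => christoffelFirst g l y j k) x :=
  differentiableAt_of_contDiffOn h.isOpen (h.smooth_christoffelFirst l j k) hx

theorem differentiableAt_christoffelFirstTrace (h : IsMetricOn g U) (hx : x ∈ U) (l : Fin n) :
    DifferentiableAt ℝ (fun y => christoffelFirstTrace g y l) x := by
  simp only [christoffelFirstTrace, Matrix.trace, Matrix.diag_apply, Matrix.mul_apply]
  exact DifferentiableAt.fun_sum fun j _ => DifferentiableAt.fun_sum fun k _ =>
    (h.differentiableAt_inv hx j k).fun_mul (h.differentiableAt_christoffelFirst hx l k j)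

theorem christoffelTrace_eq (h : IsMetricOn g U) (hx : x ∈ U) (i : Fin n) :
    christoffelTrace g i x = ((g x)⁻¹).mulVec (christoffelFirstTrace g x) i := by
  have h_trace : ∀ l, christoffelFirstTrace g x l
      = ∑ j, ∑ k, (g x)⁻¹ j k * christoffelFirst g l x j k := fun l => by
    simp only [christoffelFirstTrace, Matrix.trace, Matrix.diag_apply, Matrix.mul_apply,
      (h.christoffelFirst_isSymm hx l).apply]
  simp only [Matrix.mulVec, dotProduct, h_trace, Finset.mul_sum, christoffelTrace, christoffel]
  rw [Finset.sum_comm_cycle]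
  refine Finset.sum_congr rfl fun l _ => Finset.sum_congr rfl fun j _ =>
    Finset.sum_congr rfl fun k _ => ?_
  simp only [christoffelFirst, Matrix.of_apply]
  ring

theorem differentiableAt_christoffelTrace (h : IsMetricOn g U) (hx : x ∈ U) (i : Fin n) :
    DifferentiableAt ℝ (christoffelTrace g i) x := by
  have h_eq : christoffelTrace g i =ᶠ[nhds x]
      fun y => ((g y)⁻¹).mulVec (christoffelFirstTrace g y) i :=
    Filter.eventuallyEq_of_mem (h.isOpen.mem_nhds hx) fun _ hy => h.christoffelTrace_eq hy i
  refine DifferentiableAt.congr_of_eventuallyEq ?_ h_eq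
  simp only [Matrix.mulVec, dotProduct]
  exact DifferentiableAt.fun_sum fun l _ => (h.differentiableAt_inv hx i l).fun_mul
    (h.differentiableAt_christoffelFirstTrace hx l)

end IsMetricOn

namespace IsHomotheticOn

theorem differentiableAt_field (h : IsHomotheticOn g Y ψ U) (hx : x ∈ U) (k : Fin n) :
    DifferentiableAt ℝ (Y k) x :=
  differentiableAt_of_contDiffOn h.isOpen (h.smooth_field k) hx

theorem smooth_lowered (h : IsHomotheticOn g Y ψ U) (i : Fin n) :
    ContDiffOn ℝ ∞ (lowered g Y i) U := by
  change ContDiffOn ℝ ∞ (fun x => ∑ j, g x i j * Y j x) U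
  exact ContDiffOn.sum fun j _ => (h.smooth i j).mul (h.smooth_field j)

theorem matrixDeriv_metric (h : IsHomotheticOn g Y ψ U) (hx : x ∈ U) :
    matrixDeriv g x (fun k => Y k x)
      = (2 * ψ) • g x - (jacobian Y x).transpose * g x - g x * jacobian Y x := by
  ext i j
  have := h.lieDeriv x hx i j
  simp only [lieDerivMetric, Finset.sum_add_distrib] at this
  simp only [matrixDeriv, Matrix.of_apply, Matrix.sub_apply, Matrix.smul_apply, smul_eq_mul,
    Matrix.mul_apply, Matrix.transpose_apply, jacobian, fderiv_eq_sum_pd]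
  rw [← this, Finset.sum_congr rfl fun k _ => mul_comm (g x k j) _]
  ring

theorem matrixDeriv_inv_metric (h : IsHomotheticOn g Y ψ U) (hx : x ∈ U) :
    matrixDeriv (fun y => (g y)⁻¹) x (fun k => Y k x)
      = jacobian Y x * (g x)⁻¹ + (g x)⁻¹ * (jacobian Y x).transpose - (2 * ψ) • (g x)⁻¹ := by
  have hd := h.isUnit_det x hx
  rw [matrixDeriv_inv h.isOpen h.smooth h.isUnit_det hx, h.matrixDeriv_metric hx]
  simp only [Matrix.mul_sub, Matrix.sub_mul, Matrix.mul_smul, Matrix.smul_mul,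
    Matrix.nonsing_inv_mul _ hd, Matrix.one_mul, Matrix.nonsing_inv_mul_cancel_left _ _ hd,
    Matrix.mul_assoc, Matrix.mul_nonsing_inv _ hd, Matrix.mul_one]
  abel

theorem pd_lieDerivMetric (h : IsHomotheticOn g Y ψ U) (hx : x ∈ U) (i j m : Fin n) :
    ∑ k, (pd (Y k) m x * pd (fun y => g y i j) k x + Y k x * pd (pd (fun y => g y i j) k) m x
      + (pd (fun y => g y k j) m x * pd (Y k) i x + g x k j * pd (pd (Y k) i) m x)
      + (pd (fun y => g y i k) m x * pd (Y k) j x + g x i k * pd (pd (Y k) j) m x))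
      = 2 * ψ * pd (fun y => g y i j) m x := by
  have hY := fun k => (h.differentiableAt_field hx k).hasFDerivAt
  have hg := fun i j => (h.differentiableAt hx i j).hasFDerivAt
  have hY' := fun k i => (differentiableAt_of_contDiffOn h.isOpen
    (contDiffOn_pd h.isOpen (h.smooth_field k) i) hx).hasFDerivAt
  have hg' := fun i j k => (h.differentiableAt_pd hx i j k).hasFDerivAt
  have h_lie : HasFDerivAt (lieDerivMetric g Y i j) _ x :=
    HasFDerivAt.fun_sum (u := Finset.univ) fun k _ =>
      (((hY k).mul (hg' i j k)).add ((hg k j).mul (hY' k i))).add ((hg i k).mul (hY' k j))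
  have h_metric := (hg i j).const_mul (2 * ψ)
  have := congrArg (fun φ => φ (Pi.single m 1))
    ((fderiv_congr_of_eqOn h.isOpen (fun y hy => h.lieDeriv y hy i j) hx).symm.trans h_lie.fderiv)
  rw [h_metric.fderiv] at this
  refine Eq.trans ?_ this.symm
  simp only [_root_.sum_apply, _root_.add_apply, _root_.smul_apply, smul_eq_mul, pd]
  exact Finset.sum_congr rfl fun k _ => by ring

theorem matrixDeriv_christoffelFirst (h : IsHomotheticOn g Y ψ U) (hx : x ∈ U) (l : Fin n) :
    matrixDeriv (christoffelFirst g l) x (fun k => Y k x)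
      = (2 * ψ) • christoffelFirst g l x - ∑ m, jacobian Y x m l • christoffelFirst g m x
        - (jacobian Y x).transpose * christoffelFirst g l x
        - christoffelFirst g l x * jacobian Y x - ∑ m, g x l m • hessian (Y m) x := by
  ext j k
  have hg := fun i j k m => pd_comm h.isOpen (h.smooth i j) hx k m
  have hY := fun i k m => pd_comm h.isOpen (h.smooth_field i) hx k m
  have h_pd : ∀ m, pd (fun y => christoffelFirst g l y j k) m x = (1 / 2) *
      (pd (pd (fun y => g y l j) k) m x + pd (pd (fun y => g y l k) j) m x
        - pd (pd (fun y => g y j k) l) m x) := fun m =>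
    congrArg (fun φ => φ (Pi.single m 1))
      ((((h.differentiableAt_pd hx l j k).hasFDerivAt.add
        (h.differentiableAt_pd hx l k j).hasFDerivAt).sub
          (h.differentiableAt_pd hx j k l).hasFDerivAt).const_mul (1 / 2)).fderiv
  -- The Christoffel combination of the derivatives of `L_Y g = 2 ψ g`.
  have h_combination : ∑ m, (Y m x * pd (fun y => christoffelFirst g l y j k) m x
      + pd (Y m) l x * christoffelFirst g m x j k + pd (Y m) j x * christoffelFirst g l x m k
      + christoffelFirst g l x j m * pd (Y m) k x + g x l m * pd (pd (Y m) j) k x)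
      = 2 * ψ * christoffelFirst g l x j k := by
    have h_split : 2 * ψ * christoffelFirst g l x j k = (1 / 2) * (2 * ψ * pd (fun y => g y l j) k x
        + 2 * ψ * pd (fun y => g y l k) j x - 2 * ψ * pd (fun y => g y j k) l x) := by
      simp only [christoffelFirst, Matrix.of_apply]
      ring
    rw [h_split, ← h.pd_lieDerivMetric hx l j k, ← h.pd_lieDerivMetric hx l k j,
      ← h.pd_lieDerivMetric hx j k l, ← Finset.sum_add_distrib, ← Finset.sum_sub_distrib,
      Finset.mul_sum]
    refine Finset.sum_congr rfl fun m _ => ?_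
    rw [h_pd]
    simp only [christoffelFirst, Matrix.of_apply]
    rw [hg l j m k, hg l k m j, hg j k m l, hY m k j, hY m k l, hY m j l,
      (h.isSymm x hx).apply j m, h.pd_symm hx j m l]
    ring
  simp only [matrixDeriv, Matrix.of_apply, Matrix.sub_apply, Matrix.smul_apply, smul_eq_mul,
    Matrix.sum_apply, Matrix.mul_apply, Matrix.transpose_apply, jacobian, hessian,
    fderiv_eq_sum_pd]
  simp only [Finset.sum_add_distrib] at h_combination
  linarith

theorem fderiv_christoffelFirstTrace (h : IsHomotheticOn g Y ψ U) (hx : x ∈ U) (l : Fin n) :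
    fderiv ℝ (fun y => christoffelFirstTrace g y l) x (fun k => Y k x)
      = -((jacobian Y x).transpose.mulVec (christoffelFirstTrace g x) l)
        - (g x).mulVec (fun m => ((g x)⁻¹ * hessian (Y m) x).trace) l := by
  have hP := h.differentiableAt_inv hx
  have hΓ := h.differentiableAt_christoffelFirst hx l
  simp only [christoffelFirstTrace]
  have h_mul : ∀ i j, DifferentiableAt ℝ (fun y => ((g y)⁻¹ * christoffelFirst g l y) i j) x :=
    fun i j => by
      simp only [Matrix.mul_apply]
      exact DifferentiableAt.fun_sum fun k _ => (hP i k).fun_mul (hΓ k j)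
  rw [fderiv_trace_apply h_mul, matrixDeriv_mul hP hΓ, h.matrixDeriv_inv_metric hx,
    h.matrixDeriv_christoffelFirst hx]
  simp only [Matrix.mul_sub, Matrix.sub_mul, Matrix.add_mul, Matrix.trace_add, Matrix.trace_sub,
    Matrix.mul_smul, Matrix.smul_mul, Matrix.trace_smul, Matrix.mul_sum, Matrix.trace_sum,
    Matrix.mulVec, dotProduct, smul_eq_mul, Matrix.transpose_apply, christoffelFirstTrace]
  rw [← Matrix.mul_assoc ((g x)⁻¹) (christoffelFirst g l x) (jacobian Y x),
    Matrix.trace_mul_comm _ (jacobian Y x), Matrix.mul_assoc (jacobian Y x),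
    Matrix.mul_assoc (g x)⁻¹ (jacobian Y x).transpose]
  ring

theorem fderiv_christoffelTrace (h : IsHomotheticOn g Y ψ U) (hx : x ∈ U) (i : Fin n) :
    fderiv ℝ (christoffelTrace g i) x (fun k => Y k x)
      = (jacobian Y x).mulVec (fun j => christoffelTrace g j x) i
        - 2 * ψ * christoffelTrace g i x - ((g x)⁻¹ * hessian (Y i) x).trace := by
  have hd := h.isUnit_det x hx
  have hΓ : (fun j => christoffelTrace g j x) = ((g x)⁻¹).mulVec (christoffelFirstTrace g x) :=
    funext fun j => h.christoffelTrace_eq hx j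
  have hγ : (fun l => fderiv ℝ (fun y => christoffelFirstTrace g y l) x (fun k => Y k x))
      = -((jacobian Y x).transpose.mulVec (christoffelFirstTrace g x))
        - (g x).mulVec (fun m => ((g x)⁻¹ * hessian (Y m) x).trace) :=
    funext fun l => h.fderiv_christoffelFirstTrace hx l
  rw [fderiv_congr_of_eqOn h.isOpen (fun y hy => h.christoffelTrace_eq hy i) hx,
    fderiv_mulVec_apply (h.differentiableAt_inv hx) (h.differentiableAt_christoffelFirstTrace hx),
    hγ, h.matrixDeriv_inv_metric hx, hΓ, h.christoffelTrace_eq hx i]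
  simp only [Matrix.mulVec_sub, Matrix.mulVec_neg, Matrix.mulVec_mulVec, Matrix.add_mulVec,
    Matrix.sub_mulVec, Matrix.smul_mulVec, Matrix.nonsing_inv_mul _ hd, Matrix.one_mulVec,
    Pi.sub_apply, Pi.add_apply, Pi.neg_apply, Pi.smul_apply, smul_eq_mul]
  ring

theorem jacobian_lowered_add_transpose (h : IsHomotheticOn g Y ψ U) (hx : x ∈ U) :
    jacobian (lowered g Y) x + (jacobian (lowered g Y) x).transpose
      = (2 * ψ) • g x + (2 : ℝ) • ∑ k, Y k x • christoffelFirst g k x := by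
  ext i j
  have h_pd : ∀ i j, pd (lowered g Y i) j x
      = ∑ k, (g x i k * pd (Y k) j x + Y k x * pd (fun y => g y i k) j x) := fun i j =>
    (fderiv_sum_apply (fun k => (h.differentiableAt hx i k).fun_mul
      (h.differentiableAt_field hx k)) _).trans <| Finset.sum_congr rfl fun k _ =>
        fderiv_mul_apply (h.differentiableAt hx i k) (h.differentiableAt_field hx k) _
  simp only [Matrix.add_apply, Matrix.transpose_apply, jacobian, Matrix.of_apply, h_pd,
    Matrix.smul_apply, Matrix.sum_apply, smul_eq_mul, ← h.lieDeriv x hx i j, lieDerivMetric,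
    Finset.mul_sum, ← Finset.sum_add_distrib, christoffelFirst]
  refine Finset.sum_congr rfl fun k _ => ?_
  rw [h.pd_symm hx k i, h.pd_symm hx k j, (h.isSymm x hx).apply j k]
  ring

end IsHomotheticOn

/-- The symbol `(p, q) ↦ g^{ij} q_{ij} - Γⁱ p_i` of the Laplace operator at `x`. -/
def laplaceSymbol (g : (Fin n → ℝ) → Matrix (Fin n) (Fin n) ℝ) (x : Fin n → ℝ) :
    (Fin n → ℝ) × Matrix (Fin n) (Fin n) ℝ →ₗ[ℝ] ℝ where
  toFun w := ((g x)⁻¹ * w.2.transpose).trace - (fun i => christoffelTrace g i x) ⬝ᵥ w.1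
  map_add' w w' := by
    simp only [Prod.snd_add, Prod.fst_add, Matrix.transpose_add, Matrix.mul_add, Matrix.trace_add,
      dotProduct_add]
    ring
  map_smul' c w := by
    simp only [Prod.smul_snd, Prod.smul_fst, Matrix.transpose_smul, Matrix.mul_smul,
      Matrix.trace_smul, dotProduct_smul, smul_eq_mul, RingHom.id_apply]
    ring

theorem laplaceSymbol_apply (p : Fin n → ℝ) (Q : Matrix (Fin n) (Fin n) ℝ) :
    laplaceSymbol g x (p, Q)
      = ((g x)⁻¹ * Q.transpose).trace - (fun i => christoffelTrace g i x) ⬝ᵥ p := rfl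

theorem laplaceSymbol_vecMulVec (a b : Fin n → ℝ) :
    laplaceSymbol g x (0, Matrix.vecMulVec a b) = a ⬝ᵥ ((g x)⁻¹).mulVec b := by
  rw [laplaceSymbol_apply, dotProduct_zero, sub_zero, Matrix.transpose_vecMulVec,
    Matrix.mul_vecMulVec, Matrix.trace_vecMulVec, dotProduct_comm]

namespace IsMetricOn

theorem laplaceSymbol_metric (h : IsMetricOn g U) (hx : x ∈ U) :
    laplaceSymbol g x (0, g x) = n := by
  rw [laplaceSymbol_apply, (h.isSymm x hx).eq, Matrix.nonsing_inv_mul _ (h.isUnit_det x hx)]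
  simp

theorem differentiableAt_laplaceSymbol (h : IsMetricOn g U) (hx : x ∈ U)
    (w : (Fin n → ℝ) × Matrix (Fin n) (Fin n) ℝ) :
    DifferentiableAt ℝ (fun y => laplaceSymbol g y w) x := by
  change DifferentiableAt ℝ (fun y => ((g y)⁻¹ * w.2.transpose).trace
    - (fun i => christoffelTrace g i y) ⬝ᵥ w.1) x
  simp only [Matrix.trace, Matrix.diag_apply, Matrix.mul_apply, dotProduct]
  exact (DifferentiableAt.fun_sum fun i _ => DifferentiableAt.fun_sum fun j _ =>
    (h.differentiableAt_inv hx i j).mul_const _).fun_sub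
      (DifferentiableAt.fun_sum fun i _ => (h.differentiableAt_christoffelTrace hx i).mul_const _)

theorem fderiv_laplaceSymbol (h : IsMetricOn g U) (hx : x ∈ U) (p v : Fin n → ℝ)
    (Q : Matrix (Fin n) (Fin n) ℝ) :
    fderiv ℝ (fun y => laplaceSymbol g y (p, Q)) x v
      = (matrixDeriv (fun y => (g y)⁻¹) x v * Q.transpose).trace
        - (fun i => fderiv ℝ (christoffelTrace g i) x v) ⬝ᵥ p := by
  have h_deriv : HasFDerivAt (fun y => laplaceSymbol g y (p, Q)) _ x :=
    (HasFDerivAt.fun_sum (u := Finset.univ) fun i _ => HasFDerivAt.fun_sum (u := Finset.univ)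
      fun j _ => (h.differentiableAt_inv hx i j).hasFDerivAt.mul_const (Q i j)).sub
        (HasFDerivAt.fun_sum (u := Finset.univ) fun i _ =>
          (h.differentiableAt_christoffelTrace hx i).hasFDerivAt.mul_const (p i))
  rw [h_deriv.fderiv]
  simp only [_root_.sub_apply, _root_.sum_apply, _root_.smul_apply, smul_eq_mul, Matrix.trace,
    Matrix.diag_apply, Matrix.mul_apply, matrixDeriv, Matrix.of_apply, Matrix.transpose_apply,
    dotProduct, mul_comm]

end IsMetricOn

namespace IsHomotheticOn

theorem fderiv_laplaceSymbol_field (h : IsHomotheticOn g Y ψ U) (hx : x ∈ U) (p : Fin n → ℝ)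
    (Q : Matrix (Fin n) (Fin n) ℝ) :
    fderiv ℝ (fun y => laplaceSymbol g y (p, Q)) x (fun k => Y k x)
      = laplaceSymbol g x (Matrix.vecMul p (jacobian Y x),
          (jacobian Y x).transpose * Q + Q * jacobian Y x + ∑ k, p k • hessian (Y k) x)
        - 2 * ψ * laplaceSymbol g x (p, Q) := by
  have h_hess : ∀ k, (hessian (Y k) x).transpose = hessian (Y k) x := fun k =>
    (hessian_isSymm h.isOpen (h.smooth_field k) hx).eq
  have h_dot : (fun i => fderiv ℝ (christoffelTrace g i) x (fun k => Y k x)) ⬝ᵥ p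
      = (fun i => christoffelTrace g i x) ⬝ᵥ Matrix.vecMul p (jacobian Y x)
        - 2 * ψ * ((fun i => christoffelTrace g i x) ⬝ᵥ p)
        - ∑ k, p k * ((g x)⁻¹ * hessian (Y k) x).trace := by
    rw [dotProduct_comm _ (Matrix.vecMul _ _), ← Matrix.dotProduct_mulVec]
    simp only [h.fderiv_christoffelTrace hx, dotProduct, Finset.mul_sum, ← Finset.sum_sub_distrib]
    exact Finset.sum_congr rfl fun k _ => by ring
  rw [h.fderiv_laplaceSymbol hx, h_dot, h.matrixDeriv_inv_metric hx, laplaceSymbol_apply,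
    laplaceSymbol_apply]
  simp only [Matrix.transpose_add, Matrix.transpose_mul, Matrix.transpose_transpose,
    Matrix.transpose_sum, Matrix.transpose_smul, h_hess, Matrix.mul_add, Matrix.add_mul,
    Matrix.sub_mul, Matrix.smul_mul, Matrix.mul_sum, Matrix.mul_smul, Matrix.trace_add,
    Matrix.trace_sub, Matrix.trace_sum, Matrix.trace_smul, smul_eq_mul]
  rw [Matrix.mul_assoc (jacobian Y x), Matrix.trace_mul_comm (jacobian Y x),
    Matrix.mul_assoc (g x)⁻¹ Q.transpose, Matrix.mul_assoc (g x)⁻¹ (jacobian Y x).transpose]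
  ring

theorem laplaceSymbol_lowered (h : IsHomotheticOn g Y ψ U) (hx : x ∈ U) :
    laplaceSymbol g x (fun i => lowered g Y i x, jacobian (lowered g Y) x) = n * ψ := by
  have h_symm := h.inv_isSymm hx
  have h_dot : (fun i => christoffelTrace g i x) ⬝ᵥ (fun i => lowered g Y i x)
      = ∑ k, Y k x * christoffelFirstTrace g x k := by
    rw [funext fun i => h.christoffelTrace_eq hx i, dotProduct_comm, Matrix.dotProduct_mulVec,
      ← Matrix.mulVec_transpose, h_symm.eq, h.inv_mulVec_lowered hx]
    rfl
  have h_trace : ((g x)⁻¹ * jacobian (lowered g Y) x).trace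
      = ((g x)⁻¹ * (jacobian (lowered g Y) x).transpose).trace := by
    rw [← Matrix.trace_transpose, Matrix.transpose_mul, h_symm.eq, Matrix.trace_mul_comm]
  have h_sum := congrArg (fun L => ((g x)⁻¹ * L).trace) (h.jacobian_lowered_add_transpose hx)
  simp only [Matrix.mul_add, Matrix.trace_add, Matrix.mul_smul, Matrix.trace_smul, Matrix.mul_sum,
    Matrix.trace_sum, Matrix.nonsing_inv_mul _ (h.isUnit_det x hx), Matrix.trace_one,
    Fintype.card_fin, smul_eq_mul, h_trace] at h_sum
  rw [laplaceSymbol_apply, h_dot]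
  simp only [christoffelFirstTrace]
  linarith

end IsHomotheticOn

end Metrics

section Separated

variable {n : ℕ} {E : Type*} [NormedAddCommGroup E] [NormedSpace ℝ E] {τ : E →L[ℝ] ℝ}
  {π : E →L[ℝ] (Fin n → ℝ)} {T : ℝ → ℝ} {F : (Fin n → ℝ) → ℝ} {U : Set (Fin n → ℝ)} {S : Set E}
  {w : E}

theorem contDiffOn_separated (hT : ContDiff ℝ ∞ T) (hF : ContDiffOn ℝ ∞ F U)
    (hS : Set.MapsTo π S U) : ContDiffOn ℝ ∞ (fun y => T (τ y) * F (π y)) S :=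
  (hT.comp τ.contDiff).contDiffOn.mul (hF.comp π.contDiff.contDiffOn hS)

theorem fderiv_separated (hT : DifferentiableAt ℝ T (τ w)) (hF : DifferentiableAt ℝ F (π w))
    (d : E) : fderiv ℝ (fun y => T (τ y) * F (π y)) w d
      = T (τ w) * fderiv ℝ F (π w) (π d) + F (π w) * deriv T (τ w) * τ d := by
  have h_time : HasFDerivAt (fun y => T (τ y)) _ w := hT.hasDerivAt.comp_hasFDerivAt w τ.hasFDerivAt
  have h_space : HasFDerivAt (fun y => F (π y)) _ w := hF.hasFDerivAt.comp w π.hasFDerivAt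
  rw [fderiv_mul_apply h_time.differentiableAt h_space.differentiableAt, h_time.fderiv,
    h_space.fderiv]
  simp [mul_assoc]

theorem fderiv_comp_time (hT : DifferentiableAt ℝ T (τ w)) (d : E) :
    fderiv ℝ (fun y => T (τ y)) w d = deriv T (τ w) * τ d :=
  congrArg (fun φ => φ d) (hT.hasDerivAt.comp_hasFDerivAt w τ.hasFDerivAt).fderiv

theorem fderiv_separated_add {a : ℝ → ℝ} (hT : DifferentiableAt ℝ T (τ w))
    (hF : DifferentiableAt ℝ F (π w)) (ha : DifferentiableAt ℝ a (τ w)) (d : E) :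
    fderiv ℝ (fun y => T (τ y) * F (π y) + a (τ y)) w d = T (τ w) * fderiv ℝ F (π w) (π d)
      + (deriv T (τ w) * F (π w) + deriv a (τ w)) * τ d := by
  have h_prod : DifferentiableAt ℝ (fun y => T (τ y) * F (π y)) w :=
    (hT.comp w τ.differentiableAt).mul (hF.comp w π.differentiableAt)
  have h_time : DifferentiableAt ℝ (fun y => a (τ y)) w := ha.comp w τ.differentiableAt
  rw [fderiv_fun_add h_prod h_time, _root_.add_apply,
    fderiv_separated hT hF, fderiv_comp_time ha]
  ring

/-- Both sides are `∂_d ∂_v A = ∂_v ∂_d A`. -/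
theorem mul_pd_eq_deriv_mul_of_fderiv_eq {Z : Set E} {A : E → ℝ} {a S : ℝ → ℝ}
    {L : (Fin n → ℝ) → ℝ} {d v : E} {i : Fin n} (hZ : IsOpen Z) (hA : ContDiffOn ℝ ∞ A Z)
    (hT : Differentiable ℝ T) (ha : Differentiable ℝ a) (hS : Differentiable ℝ S) (hw : w ∈ Z)
    (hF : DifferentiableAt ℝ F (π w)) (hL : DifferentiableAt ℝ L (π w)) (hτd : τ d = 1)
    (hπd : π d = 0) (hτv : τ v = 0) (hπv : π v = Pi.single i 1)
    (hd : ∀ y ∈ Z, fderiv ℝ A y d = T (τ y) * F (π y) + a (τ y))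
    (hv : ∀ y ∈ Z, fderiv ℝ A y v = S (τ y) * L (π y)) :
    T (τ w) * pd F i (π w) = deriv S (τ w) * L (π w) := by
  have h_symm := fderiv_comm_of_eqOn hZ hA hd hv hw
  rw [fderiv_separated_add (hT _) hF (ha _), fderiv_separated (hS _) hL] at h_symm
  simpa [hτd, hπd, hτv, hπv, pd, mul_comm] using h_symm

end Separated

section FiberDerivative

variable {E : Type*} [NormedAddCommGroup E] [NormedSpace ℝ E] {U : Set E} {F : E × ℝ → ℝ} {z : E}

/-- The derivative `∂F/∂u` of a function `F (z, u)`. -/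
def fiberDeriv (F : E × ℝ → ℝ) (w : E × ℝ) : ℝ := fderiv ℝ F w (0, 1)

theorem contDiffOn_slice (hF : ContDiffOn ℝ ∞ F (U ×ˢ Set.univ)) (u : ℝ) :
    ContDiffOn ℝ ∞ (fun z => F (z, u)) U :=
  hF.comp (contDiff_id.prodMk contDiff_const).contDiffOn fun _ hz => ⟨hz, trivial⟩

theorem fderiv_slice (hU : IsOpen U) (hF : ContDiffOn ℝ ∞ F (U ×ˢ Set.univ))
    (hz : z ∈ U) (u : ℝ) (d : E) :
    fderiv ℝ (fun z => F (z, u)) z d = fderiv ℝ F (z, u) (d, 0) := by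
  rw [fderiv_prodMk_apply
    (differentiableAt_of_contDiffOn (hU.prod isOpen_univ) hF ⟨hz, trivial⟩)]
  simp

theorem hasDerivAt_fiber (hU : IsOpen U) (hF : ContDiffOn ℝ ∞ F (U ×ˢ Set.univ))
    (hz : z ∈ U) (u : ℝ) : HasDerivAt (fun u => F (z, u)) (fiberDeriv F (z, u)) u :=
  (differentiableAt_of_contDiffOn (hU.prod isOpen_univ) hF (w := (z, u))
    ⟨hz, trivial⟩).hasFDerivAt.comp_hasDerivAt u ((hasDerivAt_const u z).prodMk (hasDerivAt_id u))

theorem fderiv_apply_prodMk (w : E × ℝ) (d : E) (s : ℝ) :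
    fderiv ℝ F w (d, s) = fderiv ℝ F w (d, 0) + s * fiberDeriv F w := by
  rw [fiberDeriv, ← smul_eq_mul, ← map_smul, ← map_add]
  simp

theorem fiberDeriv_eq_sub_of_fiberDeriv_eq_zero (hU : IsOpen U)
    (hF : ContDiffOn ℝ ∞ F (U ×ˢ Set.univ)) (hz : z ∈ U)
    (h_zero : ∀ u, fiberDeriv (fiberDeriv F) (z, u) = 0) (u : ℝ) :
    fiberDeriv F (z, u) = F (z, 1) - F (z, 0) := by
  have h_fiber : ContDiffOn ℝ ∞ (fiberDeriv F) (U ×ˢ Set.univ) :=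
    contDiffOn_fderiv_apply (hU.prod isOpen_univ) hF _
  have h_deriv : ∀ s, HasDerivAt (fun s => fiberDeriv F (z, s)) 0 s := fun s => by
    simpa only [h_zero s] using hasDerivAt_fiber hU h_fiber hz s
  have h_const : ∀ s, fiberDeriv F (z, s) = fiberDeriv F (z, u) := fun s =>
    is_const_of_deriv_eq_zero (fun s => (h_deriv s).differentiableAt) (fun s => (h_deriv s).deriv)
      s u
  obtain ⟨s, -, hs⟩ := exists_hasDerivAt_eq_slope (fun s => F (z, s)) _ one_pos
    (fun s _ => (hasDerivAt_fiber hU hF hz s).continuousAt.continuousWithinAt)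
    fun s _ => hasDerivAt_fiber hU hF hz s
  rw [← h_const s, hs, sub_zero, div_one]

end FiberDerivative

section Prolongation

variable {ι : Type}

theorem hasFDerivAt_jet1_deriv (i : ι) (J : Jet1 ι) :
    HasFDerivAt (fun J : Jet1 ι => J.2.2 i) ((ContinuousLinearMap.proj i).comp
      ((ContinuousLinearMap.snd ℝ ℝ (ι → ℝ)).comp (ContinuousLinearMap.snd ℝ (ι → ℝ) _))) J :=
  ((ContinuousLinearMap.proj i).comp ((ContinuousLinearMap.snd ℝ ℝ (ι → ℝ)).comp
    (ContinuousLinearMap.snd ℝ (ι → ℝ) _))).hasFDerivAt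

variable [Fintype ι] [DecidableEq ι] {U : Set (ι → ℝ)} {F : (ι → ℝ) × ℝ → ℝ}

/-- The second order jet of the function `A` at the point `z`. -/
def functionJet (A : (ι → ℝ) → ℝ) (z : ι → ℝ) : Jet2 ι :=
  (z, A z, fun i => fderiv ℝ A z (Pi.single i 1),
    fun i j => fderiv ℝ (fun y => fderiv ℝ A y (Pi.single i 1)) z (Pi.single j 1))

/-- The second order jet of the function `z ↦ F (z, u(z))`, where `J` is the jet of `u`. -/
def totalJet (F : (ι → ℝ) × ℝ → ℝ) (J : Jet2 ι) : Jet2 ι :=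
  (J.1, F (J.1, J.2.1), fun i => totalDeriv0 F i (J.1, J.2.1, J.2.2.1),
    fun i j => totalDeriv1 (totalDeriv0 F i) j J)

/-- The components of the second prolongation of `ξⁱ ∂_i + η ∂_u` at the jet `J`. -/
def prolongation (ξ : ι → (ι → ℝ) × ℝ → ℝ) (η : (ι → ℝ) × ℝ → ℝ) (J : Jet2 ι) : Jet2 ι :=
  (fun i => ξ i (J.1, J.2.1), η (J.1, J.2.1),
    fun i => prolongCoeff1 ξ η i (J.1, J.2.1, J.2.2.1), fun i j => prolongCoeff2 ξ η i j J)

theorem functionJet_sub {A B : (ι → ℝ) → ℝ} (hU : IsOpen U) (hA : ContDiffOn ℝ ∞ A U)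
    (hB : ContDiffOn ℝ ∞ B U) {z : ι → ℝ} (hz : z ∈ U) :
    functionJet (fun y => A y - B y) z = (z, (functionJet A z).2 - (functionJet B z).2) := by
  have h_first : ∀ y ∈ U, ∀ d,
      fderiv ℝ (fun y => A y - B y) y d = fderiv ℝ A y d - fderiv ℝ B y d := fun y hy d =>
    congrArg (fun φ => φ d) (fderiv_fun_sub (differentiableAt_of_contDiffOn hU hA hy)
      (differentiableAt_of_contDiffOn hU hB hy))
  refine Prod.ext rfl (Prod.ext rfl (Prod.ext (funext fun i => h_first z hz _)
    (funext₂ fun i j => ?_)))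
  simp only [functionJet]
  rw [fderiv_congr_of_eqOn hU (fun y hy => h_first y hy _) hz,
    fderiv_fun_sub (differentiableAt_of_contDiffOn hU (contDiffOn_fderiv_apply hU hA _) hz)
      (differentiableAt_of_contDiffOn hU (contDiffOn_fderiv_apply hU hB _) hz)]
  rfl

theorem totalDeriv0_eq (hU : IsOpen U) (hF : ContDiffOn ℝ ∞ F (U ×ˢ Set.univ)) (i : ι)
    {J : Jet1 ι} (hJ : J.1 ∈ U) :
    totalDeriv0 F i J = fderiv ℝ (fun z => F (z, J.2.1)) J.1 (Pi.single i 1)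
      + J.2.2 i * fiberDeriv F (J.1, J.2.1) := by
  rw [totalDeriv0, fderiv_apply_prodMk, fderiv_slice hU hF hJ]

theorem hasFDerivAt_totalDeriv0 (hU : IsOpen U) (hF : ContDiffOn ℝ ∞ F (U ×ˢ Set.univ)) (i : ι)
    {J : Jet1 ι} (hJ : J.1 ∈ U) :
    ∃ D : Jet1 ι →L[ℝ] ℝ, HasFDerivAt (totalDeriv0 F i) D J ∧ ∀ d : Jet1 ι,
      D d = fderiv ℝ (fderiv ℝ F) (J.1, J.2.1) (d.1, d.2.1) (Pi.single i 1, J.2.2 i)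
        + d.2.2 i * fiberDeriv F (J.1, J.2.1) := by
  have h_fderiv := (differentiableAt_fderiv_of_contDiffOn (hU.prod isOpen_univ) hF
    (w := (J.1, J.2.1)) ⟨hJ, trivial⟩).hasFDerivAt
  have h_base : HasFDerivAt (fun J : Jet1 ι => (J.1, J.2.1)) _ J :=
    ((ContinuousLinearMap.fst ℝ (ι → ℝ) (ℝ × (ι → ℝ))).prod ((ContinuousLinearMap.fst ℝ ℝ _).comp
      (ContinuousLinearMap.snd ℝ (ι → ℝ) (ℝ × (ι → ℝ))))).hasFDerivAt
  have h_dir : HasFDerivAt (fun J : Jet1 ι => ((Pi.single i (1 : ℝ) : ι → ℝ), J.2.2 i)) _ J :=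
    (hasFDerivAt_const _ J).prodMk (hasFDerivAt_jet1_deriv i J)
  refine ⟨_, (h_fderiv.comp J h_base).clm_apply h_dir, fun d => ?_⟩
  have h_smul : ((0 : ι → ℝ), d.2.2 i) = d.2.2 i • ((0 : ι → ℝ), (1 : ℝ)) := by simp
  rw [fiberDeriv, ← smul_eq_mul, ← map_smul, ← h_smul, add_comm]
  rfl

theorem totalDeriv1_totalDeriv0 (hU : IsOpen U) (hF : ContDiffOn ℝ ∞ F (U ×ˢ Set.univ)) (i j : ι)
    {J : Jet2 ι} (hJ : J.1 ∈ U) :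
    totalDeriv1 (totalDeriv0 F i) j J
      = (functionJet (fun z => F (z, J.2.1)) J.1).2.2.2 i j
        + J.2.2.1 i * fderiv ℝ (fiberDeriv F) (J.1, J.2.1) (Pi.single j 1, 0)
        + J.2.2.1 j * fderiv ℝ (fiberDeriv F) (J.1, J.2.1) (Pi.single i 1, 0)
        + J.2.2.1 i * J.2.2.1 j * fiberDeriv (fiberDeriv F) (J.1, J.2.1)
        + J.2.2.2 i j * fiberDeriv F (J.1, J.2.1) := by
  have hw : (J.1, J.2.1) ∈ U ×ˢ (Set.univ : Set ℝ) := ⟨hJ, trivial⟩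
  have hUu := hU.prod (isOpen_univ (X := ℝ))
  obtain ⟨D, hD, hD_apply⟩ := hasFDerivAt_totalDeriv0 hU hF i (J := (J.1, J.2.1, J.2.2.1)) hJ
  have h_base : (functionJet (fun z => F (z, J.2.1)) J.1).2.2.2 i j
      = fderiv ℝ (fun w => fderiv ℝ F w (Pi.single i 1, 0)) (J.1, J.2.1) (Pi.single j 1, 0) := by
    rw [← fderiv_slice hU (contDiffOn_fderiv_apply hUu hF _) hJ]
    exact congrArg (fun φ => φ (Pi.single j 1))
      (fderiv_congr_of_eqOn hU (fun z hz => fderiv_slice hU hF hz _ _) hJ)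
  have h_fiber : ∀ d, fderiv ℝ (fderiv ℝ F) (J.1, J.2.1) d (0, 1)
      = fderiv ℝ (fiberDeriv F) (J.1, J.2.1) d :=
    fun d => (fderiv_fderiv_apply hUu hF hw (0, 1) d).symm
  have h_split : ∀ (k : ι) (s : ℝ), ((Pi.single k 1 : ι → ℝ), s)
      = (Pi.single k 1, 0) + s • ((0 : ι → ℝ), (1 : ℝ)) := fun k s => by simp
  rw [totalDeriv1, hD.fderiv, hD_apply, h_base, fderiv_fderiv_apply hUu hF hw,
    h_split i, h_split j]
  simp only [map_add, map_smul, _root_.add_apply, _root_.smul_apply, smul_eq_mul, h_fiber,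
    fderiv_fderiv_symm hUu hF hw _ (0, 1), fiberDeriv]
  ring

theorem prolongCoeff2_eq {ξ : ι → (ι → ℝ) × ℝ → ℝ} {η : (ι → ℝ) × ℝ → ℝ} (hU : IsOpen U)
    (hξ : ∀ k, ContDiffOn ℝ ∞ (ξ k) (U ×ˢ Set.univ)) (hη : ContDiffOn ℝ ∞ η (U ×ˢ Set.univ))
    (i j : ι) {J : Jet2 ι} (hJ : J.1 ∈ U) :
    prolongCoeff2 ξ η i j J = (totalJet η J).2.2.2 i j
      - ∑ k, (J.2.2.1 k * (totalJet (ξ k) J).2.2.2 i j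
        + J.2.2.2 k j * (totalJet (ξ k) J).2.2.1 i + J.2.2.2 i k * (totalJet (ξ k) J).2.2.1 j) := by
  have hD : ∀ {F : (ι → ℝ) × ℝ → ℝ}, ContDiffOn ℝ ∞ F (U ×ˢ Set.univ) →
      DifferentiableAt ℝ (totalDeriv0 F i) (J.1, J.2.1, J.2.2.1) := fun hF =>
    have ⟨_, hD, _⟩ := hasFDerivAt_totalDeriv0 hU hF i (J := (J.1, J.2.1, J.2.2.1)) hJ
    hD.differentiableAt
  have h_deriv : HasFDerivAt (prolongCoeff1 ξ η i) _ (J.1, J.2.1, J.2.2.1) :=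
    (hD hη).hasFDerivAt.sub (HasFDerivAt.fun_sum (u := Finset.univ) fun k _ =>
      (hasFDerivAt_jet1_deriv k _).mul (hD (hξ k)).hasFDerivAt)
  rw [prolongCoeff2, totalDeriv1, h_deriv.fderiv]
  simp only [_root_.sub_apply, _root_.sum_apply, _root_.smul_apply, smul_eq_mul,
    Finset.sum_add_distrib, mul_comm (totalDeriv0 _ _ _), ← sub_sub]
  rfl

theorem totalJet_comp_fst {B : (ι → ℝ) → ℝ} (hU : IsOpen U) (hB : ContDiffOn ℝ ∞ B U)
    {J : Jet2 ι} (hJ : J.1 ∈ U) : totalJet (fun w => B w.1) J = functionJet B J.1 := by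
  have hF : ContDiffOn ℝ ∞ (fun w : (ι → ℝ) × ℝ => B w.1) (U ×ˢ Set.univ) :=
    hB.comp contDiffOn_fst fun _ hw => hw.1
  have h_fiber : Set.EqOn (fiberDeriv fun w : (ι → ℝ) × ℝ => B w.1) (fun _ => 0)
      (U ×ˢ Set.univ) := fun w hw =>
    (hasDerivAt_fiber hU hF hw.1 w.2).unique (hasDerivAt_const w.2 (B w.1))
  have hw : (J.1, J.2.1) ∈ U ×ˢ (Set.univ : Set ℝ) := ⟨hJ, trivial⟩
  refine Prod.ext rfl (Prod.ext rfl (Prod.ext (funext fun i => ?_) (funext₂ fun i j => ?_)))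
  · simp only [totalJet, totalDeriv0_eq hU hF i (J := (J.1, J.2.1, J.2.2.1)) hJ, h_fiber hw,
      mul_zero, add_zero, functionJet]
  · have h_fiber' : fderiv ℝ (fiberDeriv fun w : (ι → ℝ) × ℝ => B w.1) (J.1, J.2.1) = 0 := by
      rw [fderiv_congr_of_eqOn (hU.prod isOpen_univ) h_fiber hw, fderiv_fun_const, Pi.zero_apply]
    simp only [totalJet, totalDeriv1_totalDeriv0 hU hF i j hJ, fiberDeriv.eq_1 (fiberDeriv _),
      h_fiber', h_fiber hw, _root_.zero_apply, mul_zero, add_zero]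

end Prolongation

section Schrodinger

variable {n : ℕ}

/-- The spatial part `x` of a point `(t, x)`. -/
def spaceProj (n : ℕ) : (Option (Fin n) → ℝ) →L[ℝ] (Fin n → ℝ) :=
  ContinuousLinearMap.pi fun i => ContinuousLinearMap.proj (some i)

/-- The time `t` of a point `(t, x)`. -/
def timeProj (n : ℕ) : (Option (Fin n) → ℝ) →L[ℝ] ℝ :=
  ContinuousLinearMap.proj none

/-- The points `(t, x)` with `x ∈ U`. -/
def cylinder (U : Set (Fin n → ℝ)) : Set (Option (Fin n) → ℝ) :=
  spaceProj n ⁻¹' U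

/-- The components of `ξ ∂_t + T(t) Yⁱ ∂_i`. -/
def liftedField (ξ : (Option (Fin n) → ℝ) × ℝ → ℝ) (T : ℝ → ℝ) (Y : Fin n → (Fin n → ℝ) → ℝ)
    (a : Option (Fin n)) (w : (Option (Fin n) → ℝ) × ℝ) : ℝ :=
  a.elim (ξ w) fun i => T (timeProj n w.1) * Y i (spaceProj n w.1)

/-- The spatial derivatives `(u_{,i}, u_{,ij})` of a jet in the variables `(t, x)`. -/
def spatialJet (J : Jet2 (Option (Fin n))) : (Fin n → ℝ) × Matrix (Fin n) (Fin n) ℝ :=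
  (fun i => J.2.2.1 (some i), Matrix.of fun i j => J.2.2.2 (some i) (some j))

@[simp]
theorem timeProj_single_none : timeProj n (Pi.single none 1) = 1 := by
  simp [timeProj]

@[simp]
theorem timeProj_single_some (i : Fin n) : timeProj n (Pi.single (some i) 1) = 0 := by
  simp [timeProj]

@[simp]
theorem spaceProj_single_none : spaceProj n (Pi.single none 1) = 0 := by
  ext k
  simp [spaceProj]

@[simp]
theorem spaceProj_single_some (i : Fin n) :
    spaceProj n (Pi.single (some i) 1) = Pi.single i 1 := by
  ext k
  simp [spaceProj, Pi.single_apply]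

theorem isOpen_cylinder {U : Set (Fin n → ℝ)} (hU : IsOpen U) : IsOpen (cylinder U) :=
  hU.preimage (spaceProj n).continuous

variable {g : (Fin n → ℝ) → Matrix (Fin n) (Fin n) ℝ} {Y : Fin n → (Fin n → ℝ) → ℝ} {ψ : ℝ}
  {U : Set (Fin n → ℝ)} {V : (Fin n → ℝ) → ℝ} {T : ℝ → ℝ}
  {ξ η : (Option (Fin n) → ℝ) × ℝ → ℝ} {J : Jet2 (Option (Fin n))}

theorem schrodinger_eq (g : (Fin n → ℝ) → Matrix (Fin n) (Fin n) ℝ) (V : (Fin n → ℝ) → ℝ)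
    (J : Jet2 (Option (Fin n))) :
    schrodinger g V J = laplaceSymbol g (spaceProj n J.1) (spatialJet J) - J.2.2.1 none
      - V (spaceProj n J.1) * J.2.1 := rfl

theorem isLinearMap_schrodinger (g : (Fin n → ℝ) → Matrix (Fin n) (Fin n) ℝ)
    (V : (Fin n → ℝ) → ℝ) (z : Option (Fin n) → ℝ) :
    IsLinearMap ℝ fun r => schrodinger g V (z, r) where
  map_add r r' := by
    have : spatialJet (z, r + r') = spatialJet (z, r) + spatialJet (z, r') := rfl
    simp only [schrodinger_eq, this, map_add, Prod.snd_add, Prod.fst_add, Pi.add_apply]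
    ring
  map_smul c r := by
    have : spatialJet (z, c • r) = c • spatialJet (z, r) := rfl
    simp only [schrodinger_eq, this, map_smul, Prod.smul_snd, Prod.smul_fst, Pi.smul_apply,
      smul_eq_mul]
    ring

namespace IsMetricOn

theorem differentiableAt_schrodinger (h : IsMetricOn g U) (hV : ContDiffOn ℝ ∞ V U)
    (hJ : J.1 ∈ cylinder U) : DifferentiableAt ℝ (schrodinger g V) J := by
  have h_space : DifferentiableAt ℝ
      (fun J : Jet2 (Option (Fin n)) => fun k => J.1 (some k)) J := by fun_prop
  have h_inv := fun i j => DifferentiableAt.fun_comp' J (h.differentiableAt_inv hJ i j) h_space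
  have h_trace := fun i =>
    DifferentiableAt.fun_comp' J (h.differentiableAt_christoffelTrace hJ i) h_space
  have h_potential := DifferentiableAt.fun_comp' J
    (differentiableAt_of_contDiffOn h.isOpen hV hJ) h_space
  have h_deriv : ∀ a, DifferentiableAt ℝ (fun J : Jet2 (Option (Fin n)) => J.2.2.1 a) J := by
    fun_prop
  have h_hess : ∀ a b, DifferentiableAt ℝ (fun J : Jet2 (Option (Fin n)) => J.2.2.2 a b) J := by
    fun_prop
  exact (((DifferentiableAt.fun_sum fun i _ => DifferentiableAt.fun_sum fun j _ =>
    (h_inv i j).fun_mul (h_hess (some i) (some j))).fun_sub (DifferentiableAt.fun_sum fun i _ =>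
      (h_trace i).fun_mul (h_deriv (some i)))).fun_sub (h_deriv none)).fun_sub
        (h_potential.fun_mul (by fun_prop))

theorem fderiv_schrodinger (h : IsMetricOn g U) (hV : ContDiffOn ℝ ∞ V U)
    (hJ : J.1 ∈ cylinder U) (d : Jet2 (Option (Fin n))) :
    fderiv ℝ (schrodinger g V) J d
      = fderiv ℝ (fun y => laplaceSymbol g y (spatialJet J)) (spaceProj n J.1) (spaceProj n d.1)
        - fderiv ℝ V (spaceProj n J.1) (spaceProj n d.1) * J.2.1
        + (laplaceSymbol g (spaceProj n J.1) (spatialJet d) - d.2.2.1 none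
          - V (spaceProj n J.1) * d.2.1) := by
  have h_base : HasFDerivAt (fun z => schrodinger g V (z, J.2)) _ J.1 :=
    ((((h.differentiableAt_laplaceSymbol hJ (spatialJet J)).hasFDerivAt.comp J.1
      (spaceProj n).hasFDerivAt).sub (hasFDerivAt_const (J.2.2.1 none) J.1)).sub
        (((differentiableAt_of_contDiffOn h.isOpen hV hJ).hasFDerivAt.comp J.1
          (spaceProj n).hasFDerivAt).mul_const J.2.1))
  have h_fiber : fderiv ℝ (fun r => schrodinger g V (J.1, r)) J.2 d.2
      = laplaceSymbol g (spaceProj n J.1) (spatialJet d) - d.2.2.1 none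
        - V (spaceProj n J.1) * d.2.1 :=
    congrArg (fun φ => φ d.2)
      ((isLinearMap_schrodinger g V J.1).mk'.toContinuousLinearMap.hasFDerivAt.fderiv)
  rw [← Prod.mk.eta (p := J),
    fderiv_prodMk_apply (h.differentiableAt_schrodinger hV (J := (J.1, J.2)) hJ), h_fiber,
    h_base.fderiv]
  simp [mul_comm]

end IsMetricOn

/-- The function `Y(V) + 2 ψ V`, which governs the symmetries along a homothetic vector field `Y`
with factor `ψ`. -/
def potentialVariation (Y : Fin n → (Fin n → ℝ) → ℝ) (ψ : ℝ) (V : (Fin n → ℝ) → ℝ)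
    (x : Fin n → ℝ) : ℝ :=
  ∑ k, Y k x * pd V k x + 2 * ψ * V x

theorem fderiv_functionJet_separated {F : (Fin n → ℝ) → ℝ} (hT : Differentiable ℝ T)
    (hU : IsOpen U) (hF : ContDiffOn ℝ ∞ F U) {z : Option (Fin n) → ℝ} (hz : z ∈ cylinder U) :
    (functionJet (fun y => T (timeProj n y) * F (spaceProj n y)) z).2.2.1 none
      = deriv T (timeProj n z) * F (spaceProj n z) := by
  simp only [functionJet]
  rw [fderiv_separated (hT _) (differentiableAt_of_contDiffOn hU hF hz)]
  simp [mul_comm]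

theorem spatialJet_functionJet_separated {F : (Fin n → ℝ) → ℝ} (hT : Differentiable ℝ T)
    (hU : IsOpen U) (hF : ContDiffOn ℝ ∞ F U) {z : Option (Fin n) → ℝ} (hz : z ∈ cylinder U) :
    spatialJet (functionJet (fun y => T (timeProj n y) * F (spaceProj n y)) z)
      = T (timeProj n z) • (fun i => pd F i (spaceProj n z), hessian F (spaceProj n z)) := by
  have h_pd : ∀ i, ∀ y ∈ cylinder U,
      fderiv ℝ (fun y => T (timeProj n y) * F (spaceProj n y)) y (Pi.single (some i) 1)
        = T (timeProj n y) * pd F i (spaceProj n y) := fun i y hy => by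
    rw [fderiv_separated (hT _) (differentiableAt_of_contDiffOn hU hF hy)]
    simp [pd]
  refine Prod.ext (funext fun i => h_pd i z hz) (Matrix.ext fun i j => ?_)
  simp only [spatialJet, functionJet, Matrix.of_apply]
  rw [fderiv_congr_of_eqOn (isOpen_cylinder hU) (h_pd i) hz,
    fderiv_separated (hT _) (differentiableAt_of_contDiffOn hU (contDiffOn_pd hU hF i) hz)]
  simp [hessian, pd]

theorem schrodinger_totalJet (h : IsMetricOn g U) (hη : ContDiffOn ℝ ∞ η (cylinder U ×ˢ Set.univ))
    (hJ : J.1 ∈ cylinder U) :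
    schrodinger g V (totalJet η J)
      = schrodinger g V (functionJet (fun z => η (z, J.2.1)) J.1)
        + fiberDeriv η (J.1, J.2.1) * (schrodinger g V J + V (spaceProj n J.1) * J.2.1)
        + 2 * ((fun i => fderiv ℝ (fiberDeriv η) (J.1, J.2.1) (Pi.single (some i) 1, 0))
          ⬝ᵥ (g (spaceProj n J.1))⁻¹.mulVec (spatialJet J).1)
        + fiberDeriv (fiberDeriv η) (J.1, J.2.1)
          * ((spatialJet J).1 ⬝ᵥ (g (spaceProj n J.1))⁻¹.mulVec (spatialJet J).1) := by
  set p := (spatialJet J).1 with hp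
  set m : Fin n → ℝ := fun i => fderiv ℝ (fiberDeriv η) (J.1, J.2.1) (Pi.single (some i) 1, 0)
    with hm
  have h_symm : p ⬝ᵥ (g (spaceProj n J.1))⁻¹.mulVec m = m ⬝ᵥ (g (spaceProj n J.1))⁻¹.mulVec p := by
    rw [Matrix.dotProduct_mulVec, ← Matrix.mulVec_transpose, (h.inv_isSymm hJ).eq, dotProduct_comm]
  have h_time : (totalJet η J).2.2.1 none
      = (functionJet (fun z => η (z, J.2.1)) J.1).2.2.1 none
        + J.2.2.1 none * fiberDeriv η (J.1, J.2.1) :=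
    totalDeriv0_eq (isOpen_cylinder h.isOpen) hη none (J := (J.1, J.2.1, J.2.2.1)) hJ
  have h_spatial : spatialJet (totalJet η J)
      = spatialJet (functionJet (fun z => η (z, J.2.1)) J.1)
        + fiberDeriv η (J.1, J.2.1) • spatialJet J
        + ((0, Matrix.vecMulVec p m) + (0, Matrix.vecMulVec m p))
        + fiberDeriv (fiberDeriv η) (J.1, J.2.1) • (0, Matrix.vecMulVec p p) := by
    refine Prod.ext (funext fun i => ?_) (Matrix.ext fun i j => ?_)
    · simp [spatialJet, totalJet, functionJet, mul_comm,
        totalDeriv0_eq (isOpen_cylinder h.isOpen) hη (some i) (J := (J.1, J.2.1, J.2.2.1)) hJ]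
    · simp only [spatialJet, totalJet, Prod.snd_add, Prod.smul_snd, Matrix.add_apply,
        Matrix.smul_apply, Matrix.of_apply, Matrix.vecMulVec_apply, smul_eq_mul,
        totalDeriv1_totalDeriv0 (isOpen_cylinder h.isOpen) hη (some i) (some j) hJ, hp, hm]
      ring
  rw [schrodinger_eq, h_time, h_spatial, schrodinger_eq g V (functionJet _ _),
    schrodinger_eq g V J]
  simp only [map_add, map_smul, laplaceSymbol_vecMulVec, smul_eq_mul]
  simp only [totalJet, functionJet, h_symm]
  ring

namespace IsHomotheticOn

theorem contDiffOn_liftedField (h : IsHomotheticOn g Y ψ U) (hT : ContDiff ℝ ∞ T)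
    (hξ : ContDiffOn ℝ ∞ ξ (cylinder U ×ˢ Set.univ)) (a : Option (Fin n)) :
    ContDiffOn ℝ ∞ (liftedField ξ T Y a) (cylinder U ×ˢ Set.univ) :=
  match a with
  | none => hξ
  | some i => contDiffOn_separated (τ := (timeProj n).comp (ContinuousLinearMap.fst ℝ _ ℝ))
      (π := (spaceProj n).comp (ContinuousLinearMap.fst ℝ _ ℝ)) hT (h.smooth_field i)
      fun _ hw => hw.1

theorem totalJet_liftedField_some (h : IsHomotheticOn g Y ψ U) (hT : ContDiff ℝ ∞ T)
    (hJ : J.1 ∈ cylinder U) (k : Fin n) : totalJet (liftedField ξ T Y (some k)) J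
      = functionJet (fun y => T (timeProj n y) * Y k (spaceProj n y)) J.1 :=
  totalJet_comp_fst (isOpen_cylinder h.isOpen)
    (contDiffOn_separated hT (h.smooth_field k) (Set.mapsTo_preimage _ _)) hJ

theorem prolongation_liftedField_none (h : IsHomotheticOn g Y ψ U) (hT : ContDiff ℝ ∞ T)
    (hJ : J.1 ∈ cylinder U) :
    (prolongation (liftedField ξ T Y) η J).2.2.1 none
      = (totalJet η J).2.2.1 none - J.2.2.1 none * (totalJet ξ J).2.2.1 none
        - deriv T (timeProj n J.1) * ((spatialJet J).1 ⬝ᵥ fun k => Y k (spaceProj n J.1)) := by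
  change (totalJet η J).2.2.1 none
    - ∑ a, J.2.2.1 a * (totalJet (liftedField ξ T Y a) J).2.2.1 none = _
  simp only [Fintype.sum_option, h.totalJet_liftedField_some hT hJ,
    fderiv_functionJet_separated (hT.differentiable (by simp)) h.isOpen (h.smooth_field _) hJ,
    dotProduct, Finset.mul_sum, ← sub_sub, spatialJet, mul_left_comm]
  rfl

theorem spatialJet_prolongation_liftedField (h : IsHomotheticOn g Y ψ U) (hT : ContDiff ℝ ∞ T)
    (hξ : ContDiffOn ℝ ∞ ξ (cylinder U ×ˢ Set.univ))
    (hη : ContDiffOn ℝ ∞ η (cylinder U ×ˢ Set.univ)) (hJ : J.1 ∈ cylinder U) :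
    spatialJet (prolongation (liftedField ξ T Y) η J)
      = spatialJet (totalJet η J) - J.2.2.1 none • spatialJet (totalJet ξ J)
        - ((0, Matrix.vecMulVec (spatialJet (totalJet ξ J)).1 fun j => J.2.2.2 none (some j))
          + (0, Matrix.vecMulVec (fun i => J.2.2.2 (some i) none) (spatialJet (totalJet ξ J)).1))
        - T (timeProj n J.1) • (Matrix.vecMul (spatialJet J).1 (jacobian Y (spaceProj n J.1)),
          (jacobian Y (spaceProj n J.1)).transpose * (spatialJet J).2
            + (spatialJet J).2 * jacobian Y (spaceProj n J.1)
            + ∑ k, (spatialJet J).1 k • hessian (Y k) (spaceProj n J.1)) := by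
  have h_jet := fun k => spatialJet_functionJet_separated (hT.differentiable (by simp)) h.isOpen
    (h.smooth_field k) hJ
  have h_pd : ∀ k i, (totalJet (liftedField ξ T Y (some k)) J).2.2.1 (some i)
      = T (timeProj n J.1) * pd (Y k) i (spaceProj n J.1) := fun k i => by
    rw [h.totalJet_liftedField_some hT hJ]
    exact congrFun (congrArg Prod.fst (h_jet k)) i
  have h_hess : ∀ k i j, (totalJet (liftedField ξ T Y (some k)) J).2.2.2 (some i) (some j)
      = T (timeProj n J.1) * hessian (Y k) (spaceProj n J.1) i j := fun k i j => by
    rw [h.totalJet_liftedField_some hT hJ]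
    exact congrFun₂ (congrArg Prod.snd (h_jet k)) i j
  have h_none : totalJet (liftedField ξ T Y none) J = totalJet ξ J := rfl
  refine Prod.ext (funext fun i => ?_) (Matrix.ext fun i j => ?_)
  · change (totalJet η J).2.2.1 (some i)
      - ∑ a, J.2.2.1 a * (totalJet (liftedField ξ T Y a) J).2.2.1 (some i) = _
    simp only [Fintype.sum_option, h_none, h_pd, Prod.fst_sub, Prod.fst_add, Prod.smul_fst,
      Pi.sub_apply, Pi.smul_apply, Pi.add_apply, Pi.zero_apply, smul_eq_mul, Matrix.vecMul,
      dotProduct, jacobian, Matrix.of_apply, Finset.mul_sum, spatialJet, mul_left_comm (T _)]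
    ring
  · change prolongCoeff2 (liftedField ξ T Y) η (some i) (some j) J = _
    simp only [spatialJet, Matrix.of_apply, prolongCoeff2_eq (isOpen_cylinder h.isOpen)
      (h.contDiffOn_liftedField hT hξ) hη _ _ hJ, Fintype.sum_option, h_none, h_pd, h_hess,
      Prod.snd_sub, Prod.snd_add, Prod.smul_snd, Matrix.sub_apply, Matrix.add_apply,
      Matrix.smul_apply, Matrix.mul_apply, Matrix.sum_apply, Matrix.transpose_apply,
      Matrix.vecMulVec_apply, jacobian, smul_eq_mul, mul_add, Finset.mul_sum,
      Finset.sum_add_distrib, mul_left_comm (T _), mul_comm (pd _ _ _)]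
    ring

theorem prolong2_schrodinger (h : IsHomotheticOn g Y ψ U) (hV : ContDiffOn ℝ ∞ V U)
    (hT : ContDiff ℝ ∞ T) (hξ : ContDiffOn ℝ ∞ ξ (cylinder U ×ˢ Set.univ))
    (hη : ContDiffOn ℝ ∞ η (cylinder U ×ˢ Set.univ)) (hJ : J.1 ∈ cylinder U) :
    prolong2 (liftedField ξ T Y) η (schrodinger g V) J
      = schrodinger g V (totalJet η J) - 2 * ψ * T (timeProj n J.1) * schrodinger g V J
        + deriv T (timeProj n J.1) * ((spatialJet J).1 ⬝ᵥ fun k => Y k (spaceProj n J.1))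
        - T (timeProj n J.1) * potentialVariation Y ψ V (spaceProj n J.1) * J.2.1
        + J.2.2.1 none * ((totalJet ξ J).2.2.1 none - 2 * ψ * T (timeProj n J.1)
          - laplaceSymbol g (spaceProj n J.1) (spatialJet (totalJet ξ J)))
        - ((spatialJet (totalJet ξ J)).1
            ⬝ᵥ (g (spaceProj n J.1))⁻¹.mulVec (fun j => J.2.2.2 none (some j))
          + (fun i => J.2.2.2 (some i) none)
            ⬝ᵥ (g (spaceProj n J.1))⁻¹.mulVec (spatialJet (totalJet ξ J)).1) := by
  have h_field : spaceProj n (prolongation (liftedField ξ T Y) η J).1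
      = T (timeProj n J.1) • fun k => Y k (spaceProj n J.1) := rfl
  have h_laplace := h.fderiv_laplaceSymbol_field hJ (spatialJet J).1 (spatialJet J).2
  have h_value : (prolongation (liftedField ξ T Y) η J).2.1 = (totalJet η J).2.1 := rfl
  have h_base : (totalJet η J).1 = J.1 := rfl
  change fderiv ℝ (schrodinger g V) J (prolongation (liftedField ξ T Y) η J) = _
  rw [h.fderiv_schrodinger hV hJ, h_field, map_smul, map_smul, h_laplace, fderiv_eq_sum_pd V,
    h.spatialJet_prolongation_liftedField hT hξ hη hJ, h.prolongation_liftedField_none hT hJ,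
    schrodinger_eq g V (totalJet η J), schrodinger_eq g V J]
  simp only [map_add, map_sub, map_smul, laplaceSymbol_vecMulVec, smul_eq_mul, Prod.mk.eta,
    potentialVariation, h_value, h_base]
  ring

end IsHomotheticOn

theorem IsHomotheticOn.contDiffOn_potentialVariation (h : IsHomotheticOn g Y ψ U)
    (hV : ContDiffOn ℝ ∞ V U) : ContDiffOn ℝ ∞ (potentialVariation Y ψ V) U :=
  (ContDiffOn.sum fun k _ => (h.smooth_field k).mul (contDiffOn_pd h.isOpen hV k)).add
    (contDiffOn_const.mul hV)

/-- The determining equations, beside `ξ_{,t} = 2 ψ T`, of a symmetry `ξ ∂_t + T Yⁱ ∂_i + A u ∂_u`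
of the Schrödinger equation with `ξ = ξ(t)`. -/
structure IsLieMultiplier (g : (Fin n → ℝ) → Matrix (Fin n) (Fin n) ℝ)
    (Y : Fin n → (Fin n → ℝ) → ℝ) (ψ : ℝ) (V : (Fin n → ℝ) → ℝ) (T : ℝ → ℝ)
    (U : Set (Fin n → ℝ)) (A : (Option (Fin n) → ℝ) → ℝ) : Prop where
  smooth : ContDiffOn ℝ ∞ A (cylinder U)
  grad : ∀ z ∈ cylinder U, ∀ i, fderiv ℝ A z (Pi.single (some i) 1)
    = -(1 / 2) * deriv T (timeProj n z) * lowered g Y i (spaceProj n z)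
  time : ∀ z ∈ cylinder U, fderiv ℝ A z (Pi.single none 1)
    = -T (timeProj n z) * potentialVariation Y ψ V (spaceProj n z)
      + -(1 / 2) * n * ψ * deriv T (timeProj n z)

theorem spatialJet_functionJet_comp_timeProj {S : ℝ → ℝ} (hS : Differentiable ℝ S)
    (z : Option (Fin n) → ℝ) : spatialJet (functionJet (fun y => S (timeProj n y)) z) = 0 := by
  refine Prod.ext (funext fun i => ?_) (Matrix.ext fun i j => ?_) <;>
    simp [spatialJet, functionJet, fderiv_comp_time (hS _)]

theorem IsHomotheticOn.schrodinger_functionJet_of_grad (h : IsHomotheticOn g Y ψ U)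
    {A : (Option (Fin n) → ℝ) → ℝ} {S : ℝ → ℝ} (hS : Differentiable ℝ S)
    (hA : ∀ y ∈ cylinder U, ∀ i, fderiv ℝ A y (Pi.single (some i) 1)
      = S (timeProj n y) * lowered g Y i (spaceProj n y))
    {z : Option (Fin n) → ℝ} (hz : z ∈ cylinder U) :
    schrodinger g V (functionJet A z)
      = S (timeProj n z) * (n * ψ) - fderiv ℝ A z (Pi.single none 1)
        - V (spaceProj n z) * A z := by
  have h_spatial : spatialJet (functionJet A z) = S (timeProj n z) •
      (fun i => lowered g Y i (spaceProj n z), jacobian (lowered g Y) (spaceProj n z)) := by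
    refine Prod.ext (funext fun i => hA z hz i) (Matrix.ext fun i j => ?_)
    simp only [spatialJet, functionJet, Matrix.of_apply]
    rw [fderiv_congr_of_eqOn (isOpen_cylinder h.isOpen) (fun y hy => hA y hy i) hz,
      fderiv_separated (hS _) (differentiableAt_of_contDiffOn h.isOpen (h.smooth_lowered i) hz)]
    simp [jacobian, pd]
  rw [schrodinger_eq, h_spatial, map_smul]
  simp only [functionJet]
  rw [h.laplaceSymbol_lowered hz, smul_eq_mul]

theorem schrodinger_totalJet_linear (h : IsMetricOn g U) {A : (Option (Fin n) → ℝ) → ℝ}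
    (hA : ContDiffOn ℝ ∞ A (cylinder U)) (hJ : J.1 ∈ cylinder U) :
    schrodinger g V (totalJet (fun w => A w.1 * w.2) J)
      = schrodinger g V (functionJet (fun z => A z * J.2.1) J.1)
        + A J.1 * (schrodinger g V J + V (spaceProj n J.1) * J.2.1)
        + 2 * ((fun i => fderiv ℝ A J.1 (Pi.single (some i) 1))
          ⬝ᵥ (g (spaceProj n J.1))⁻¹.mulVec (spatialJet J).1) := by
  have hZ := isOpen_cylinder h.isOpen
  have hZu := hZ.prod (isOpen_univ (X := ℝ))
  have hJu : (J.1, J.2.1) ∈ cylinder U ×ˢ (Set.univ : Set ℝ) := ⟨hJ, trivial⟩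
  have hA' : ContDiffOn ℝ ∞ (fun w : (Option (Fin n) → ℝ) × ℝ => A w.1)
      (cylinder U ×ˢ Set.univ) := hA.comp contDiffOn_fst fun _ hw => hw.1
  have hη : ContDiffOn ℝ ∞ (fun w : (Option (Fin n) → ℝ) × ℝ => A w.1 * w.2)
      (cylinder U ×ˢ Set.univ) := hA'.mul contDiffOn_snd
  have h_fiber : Set.EqOn (fiberDeriv fun w : (Option (Fin n) → ℝ) × ℝ => A w.1 * w.2)
      (fun w => A w.1) (cylinder U ×ˢ Set.univ) := fun w hw =>
    (hasDerivAt_fiber hZ hη hw.1 w.2).unique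
      (by simpa using (hasDerivAt_id w.2).const_mul (A w.1))
  have h_base : HasFDerivAt (fun w : (Option (Fin n) → ℝ) × ℝ => A w.1) _ (J.1, J.2.1) :=
    (differentiableAt_of_contDiffOn hZ hA hJ).hasFDerivAt.comp (J.1, J.2.1)
      (ContinuousLinearMap.fst ℝ (Option (Fin n) → ℝ) ℝ).hasFDerivAt
  rw [schrodinger_totalJet h hη hJ, fiberDeriv.eq_1 (fiberDeriv _),
    fderiv_congr_of_eqOn hZu h_fiber hJu, h_fiber hJu, h_base.fderiv]
  simp

namespace IsHomotheticOn

theorem schrodinger_functionJet_mul (h : IsHomotheticOn g Y ψ U) (hT : ContDiff ℝ ∞ T)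
    {A : (Option (Fin n) → ℝ) → ℝ} (hA : IsLieMultiplier g Y ψ V T U A)
    {z : Option (Fin n) → ℝ} (hz : z ∈ cylinder U) (u : ℝ) :
    schrodinger g V (functionJet (fun z => A z * u) z)
      = T (timeProj n z) * potentialVariation Y ψ V (spaceProj n z) * u
        - V (spaceProj n z) * (A z * u) := by
  have h_mul : ∀ y ∈ cylinder U, ∀ d, fderiv ℝ (fun z => A z * u) y d = u * fderiv ℝ A y d :=
    fun y hy d => congrArg (fun φ => φ d)
      (fderiv_mul_const (differentiableAt_of_contDiffOn (isOpen_cylinder h.isOpen) hA.smooth hy) u)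
  rw [h.schrodinger_functionJet_of_grad (S := fun t => -(1 / 2) * deriv T t * u)
    ((((contDiff_infty_iff_deriv.1 hT).2.differentiable (by simp)).const_mul _).mul_const u)
    (fun y hy i => ?_) hz, h_mul z hz, hA.time z hz]
  · ring
  · rw [h_mul y hy, hA.grad y hy]
    ring

theorem isLiePointSymmetryOn_of_isLieMultiplier (h : IsHomotheticOn g Y ψ U)
    (hV : ContDiffOn ℝ ∞ V U) (hT : ContDiff ℝ ∞ T) {α : ℝ → ℝ} (hα : ContDiff ℝ ∞ α)
    (hα' : ∀ t, deriv α t = -T t) {A : (Option (Fin n) → ℝ) → ℝ}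
    (hA : IsLieMultiplier g Y ψ V T U A) :
    IsLiePointSymmetryOn (schrodinger g V) (cylinder U)
      (liftedField (fun w => -2 * ψ * α (timeProj n w.1)) T Y) (fun w => A w.1 * w.2) := by
  have hZ := isOpen_cylinder h.isOpen
  have hξ : ContDiffOn ℝ ∞ (fun z => -2 * ψ * α (timeProj n z)) (cylinder U) :=
    (contDiff_const.mul (hα.comp (timeProj n).contDiff)).contDiffOn
  have hξ' : ContDiffOn ℝ ∞ (fun w : (Option (Fin n) → ℝ) × ℝ => -2 * ψ * α (timeProj n w.1))
      (cylinder U ×ˢ Set.univ) := hξ.comp contDiffOn_fst fun _ hw => hw.1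
  have hη : ContDiffOn ℝ ∞ (fun w : (Option (Fin n) → ℝ) × ℝ => A w.1 * w.2)
      (cylinder U ×ˢ Set.univ) :=
    (hA.smooth.comp contDiffOn_fst fun _ hw => hw.1).mul contDiffOn_snd
  refine ⟨h.contDiffOn_liftedField hT hξ', hη, fun J => A J.1 - 2 * ψ * T (timeProj n J.1),
    fun J hJ _ => ?_⟩
  have dξ := (hα.differentiable (by simp)).const_mul (-2 * ψ)
  have h_none : (functionJet (fun z => -2 * ψ * α (timeProj n z)) J.1).2.2.1 none
      = 2 * ψ * T (timeProj n J.1) := by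
    simp only [functionJet]
    rw [fderiv_comp_time (dξ _), deriv_const_mul_field, hα', timeProj_single_none]
    ring
  have h_grad' : (fun i => fderiv ℝ A J.1 (Pi.single (some i) 1))
      = (-(1 / 2) * deriv T (timeProj n J.1)) • fun i => lowered g Y i (spaceProj n J.1) :=
    funext fun i => hA.grad J.1 hJ i
  rw [h.prolong2_schrodinger hV hT hξ' hη hJ,
    schrodinger_totalJet_linear h.toIsMetricOn hA.smooth hJ, totalJet_comp_fst hZ hξ hJ, h_none,
    spatialJet_functionJet_comp_timeProj dξ, h.schrodinger_functionJet_mul hT hA hJ, h_grad',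
    smul_dotProduct, h.lowered_dotProduct_inv_mulVec hJ]
  simp only [one_div, neg_mul, smul_eq_mul, mul_neg, sub_self, map_zero, mul_zero, add_zero,
    Prod.fst_zero, zero_dotProduct, Matrix.mulVec_zero, dotProduct_zero, sub_zero]
  ring

theorem isLiePointSymmetryOn (h : IsHomotheticOn g Y ψ U) (hV : ContDiffOn ℝ ∞ V U)
    {c : ℝ} (hc : ∀ x ∈ U, ∀ i, pd (potentialVariation Y ψ V) i x = c * lowered g Y i x)
    {α : ℝ → ℝ} (hT : ContDiff ℝ ∞ T) (hα : ContDiff ℝ ∞ α) (hα' : ∀ t, deriv α t = -T t)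
    (hT' : ∀ t, deriv T t = -2 * c * α t) :
    IsLiePointSymmetryOn (schrodinger g V) (cylinder U)
      (liftedField (fun w => -2 * ψ * α (timeProj n w.1)) T Y)
      (fun w => (α (timeProj n w.1) * potentialVariation Y ψ V (spaceProj n w.1)
        + -(1 / 2) * n * ψ * T (timeProj n w.1)) * w.2) := by
  have hW := h.contDiffOn_potentialVariation hV
  have dT : Differentiable ℝ T := hT.differentiable (by simp)
  have dα : Differentiable ℝ α := hα.differentiable (by simp)
  have h_fderiv := fun z (hz : z ∈ cylinder U) => fderiv_separated_add (τ := timeProj n)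
    (π := spaceProj n) (dα _) (differentiableAt_of_contDiffOn h.isOpen hW hz)
    ((dT _).const_mul (-(1 / 2) * n * ψ))
  refine h.isLiePointSymmetryOn_of_isLieMultiplier hV hT hα hα'
    (A := fun z => α (timeProj n z) * potentialVariation Y ψ V (spaceProj n z)
      + -(1 / 2) * n * ψ * T (timeProj n z))
    ⟨(contDiffOn_separated hα hW (Set.mapsTo_preimage _ _)).add
      (contDiff_const.mul (hT.comp (timeProj n).contDiff)).contDiffOn,
      fun z hz i => ?_, fun z hz => ?_⟩
  · rw [h_fderiv z hz, spaceProj_single_some, ← pd, hc _ hz, hT', timeProj_single_some]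
    ring
  · rw [h_fderiv z hz, hα', deriv_const_mul_field]
    simp

end IsHomotheticOn

/-- A jet with `u_{,t} = u_{,ti} = 0`, gradient `p` and `u_{,ij} = κ g_{ij}`. On such jets the
prolongation of `ξ ∂_t` has no effect on the Schrödinger operator. -/
def staticJet (g : (Fin n → ℝ) → Matrix (Fin n) (Fin n) ℝ) (z : Option (Fin n) → ℝ) (u : ℝ)
    (p : Fin n → ℝ) (κ : ℝ) : Jet2 (Option (Fin n)) :=
  (z, u, fun a => a.elim 0 p, fun a b => a.elim 0 fun i => b.elim 0 fun j =>
    κ * g (spaceProj n z) i j)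

theorem IsMetricOn.schrodinger_staticJet (h : IsMetricOn g U) {z : Option (Fin n) → ℝ}
    (hz : z ∈ cylinder U) (u : ℝ) (p : Fin n → ℝ) (κ : ℝ) :
    schrodinger g V (staticJet g z u p κ)
      = laplaceSymbol g (spaceProj n z) (p, 0) + κ * n - V (spaceProj n z) * u := by
  have h_spatial : spatialJet (staticJet g z u p κ) = (p, 0) + κ • (0, g (spaceProj n z)) :=
    Prod.ext (by simp [spatialJet, staticJet]) (by ext; simp [spatialJet, staticJet])
  rw [schrodinger_eq, h_spatial, map_add, map_smul]
  simp only [staticJet]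
  rw [h.laplaceSymbol_metric hz]
  simp

namespace IsHomotheticOn

theorem prolong2_schrodinger_staticJet (h : IsHomotheticOn g Y ψ U) (hV : ContDiffOn ℝ ∞ V U)
    (hT : ContDiff ℝ ∞ T) (hξ : ContDiffOn ℝ ∞ ξ (cylinder U ×ˢ Set.univ))
    (hη : ContDiffOn ℝ ∞ η (cylinder U ×ˢ Set.univ)) {z : Option (Fin n) → ℝ}
    (hz : z ∈ cylinder U) {u κ : ℝ} {v : Fin n → ℝ}
    (hκ : schrodinger g V (staticJet g z u ((g (spaceProj n z)).mulVec v) κ) = 0) :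
    prolong2 (liftedField ξ T Y) η (schrodinger g V)
        (staticJet g z u ((g (spaceProj n z)).mulVec v) κ)
      = fiberDeriv (fiberDeriv η) (z, u) * (v ⬝ᵥ (g (spaceProj n z)).mulVec v)
        + (fun i => 2 * fderiv ℝ (fiberDeriv η) (z, u) (Pi.single (some i) 1, 0)
          + deriv T (timeProj n z) * lowered g Y i (spaceProj n z)) ⬝ᵥ v
        + (schrodinger g V (functionJet (fun y => η (y, u)) z)
          + fiberDeriv η (z, u) * (V (spaceProj n z) * u)
          - T (timeProj n z) * potentialVariation Y ψ V (spaceProj n z) * u) := by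
  have h_cancel : (g (spaceProj n z))⁻¹.mulVec ((g (spaceProj n z)).mulVec v) = v := by
    rw [Matrix.mulVec_mulVec, Matrix.nonsing_inv_mul _ (h.isUnit_det _ hz), Matrix.one_mulVec]
  have h_symm : (g (spaceProj n z)).mulVec v ⬝ᵥ (fun k => Y k (spaceProj n z))
      = (fun i => lowered g Y i (spaceProj n z)) ⬝ᵥ v := by
    rw [← h.lowered_dotProduct_inv_mulVec hz, h_cancel]
  have h_spatial : (spatialJet (staticJet g z u ((g (spaceProj n z)).mulVec v) κ)).1
      = (g (spaceProj n z)).mulVec v := rfl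
  rw [h.prolong2_schrodinger hV hT hξ hη hz, schrodinger_totalJet h.toIsMetricOn hη hz, hκ,
    h_spatial]
  have h_dot : (fun i => 2 * fderiv ℝ (fiberDeriv η) (z, u) (Pi.single (some i) 1, 0)
      + deriv T (timeProj n z) * lowered g Y i (spaceProj n z)) ⬝ᵥ v
      = 2 * ((fun i => fderiv ℝ (fiberDeriv η) (z, u) (Pi.single (some i) 1, 0)) ⬝ᵥ v)
        + deriv T (timeProj n z) * ((fun i => lowered g Y i (spaceProj n z)) ⬝ᵥ v) := by
    rw [← smul_eq_mul, ← smul_dotProduct, ← smul_eq_mul (deriv T _), ← smul_dotProduct,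
      ← add_dotProduct]
    rfl
  simp only [staticJet, h_cancel, h_symm, h_dot, Option.elim, ← Pi.zero_def, Matrix.mulVec_zero,
    dotProduct_zero, zero_dotProduct, dotProduct_comm (Matrix.mulVec _ v) v]
  ring

theorem lie_determining_equations [Nonempty (Fin n)] (h : IsHomotheticOn g Y ψ U)
    (hV : ContDiffOn ℝ ∞ V U) (hT : ContDiff ℝ ∞ T)
    (h_lie : IsLiePointSymmetryOn (schrodinger g V) (cylinder U) (liftedField ξ T Y) η)
    {z : Option (Fin n) → ℝ} (hz : z ∈ cylinder U) (u : ℝ) :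
    fiberDeriv (fiberDeriv η) (z, u) = 0 ∧
      (∀ i, fderiv ℝ (fiberDeriv η) (z, u) (Pi.single (some i) 1, 0)
        = -(1 / 2) * deriv T (timeProj n z) * lowered g Y i (spaceProj n z)) ∧
      schrodinger g V (functionJet (fun y => η (y, u)) z)
        + fiberDeriv η (z, u) * (V (spaceProj n z) * u)
        - T (timeProj n z) * potentialVariation Y ψ V (spaceProj n z) * u = 0 := by
  obtain ⟨hX, hη, μ, hμ⟩ := h_lie
  have h_sol : ∀ p, ∃ κ, schrodinger g V (staticJet g z u p κ) = 0 := fun p =>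
    ⟨(V (spaceProj n z) * u - laplaceSymbol g (spaceProj n z) (p, 0)) / n, by
      have hn : (n : ℝ) ≠ 0 := Nat.cast_ne_zero.2 (Fin.pos_iff_nonempty.2 ‹_›).ne'
      rw [h.schrodinger_staticJet hz]
      field_simp
      ring⟩
  have h_jet_symm : ∀ p κ a b,
      (staticJet g z u p κ).2.2.2 a b = (staticJet g z u p κ).2.2.2 b a := fun p κ a b => by
    rcases a with _ | i <;> rcases b with _ | j <;> simp only [staticJet, Option.elim]
    rw [(h.isSymm _ hz).apply]
  have h_poly := fun v =>
    have ⟨κ, hκ⟩ := h_sol ((g (spaceProj n z)).mulVec v)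
    (h.prolong2_schrodinger_staticJet hV hT (hX none) hη hz hκ).symm.trans
      ((hμ _ hz (h_jet_symm _ κ)).trans (by rw [hκ, mul_zero]))
  obtain ⟨-, h_uu, h_grad, h_rest⟩ := coeffs_eq_zero_of_forall_cubic_dotProduct_eq_zero (l := 0)
    (a := fiberDeriv (fiberDeriv η) (z, u))
    (m := fun i => 2 * fderiv ℝ (fiberDeriv η) (z, u) (Pi.single (some i) 1, 0)
      + deriv T (timeProj n z) * lowered g Y i (spaceProj n z))
    (h.isSymm _ hz) (h.isUnit_det _ hz) fun v => by
      rw [zero_dotProduct, zero_add]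
      exact h_poly v
  refine ⟨h_uu, fun i => ?_, h_rest⟩
  have h_grad_i : _ = (0 : ℝ) := congrFun h_grad i
  linarith

theorem exists_isLieMultiplier [Nonempty (Fin n)] (h : IsHomotheticOn g Y ψ U)
    (hV : ContDiffOn ℝ ∞ V U) (hT : ContDiff ℝ ∞ T)
    (h_lie : IsLiePointSymmetryOn (schrodinger g V) (cylinder U) (liftedField ξ T Y) η) :
    ∃ A, IsLieMultiplier g Y ψ V T U A := by
  have hZ := isOpen_cylinder h.isOpen
  have hη := h_lie.2.1
  have hηu := fun u => contDiffOn_slice hη u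
  have h_det := fun z (hz : z ∈ cylinder U) => h.lie_determining_equations hV hT h_lie hz
  have h_fiber : ContDiffOn ℝ ∞ (fiberDeriv η) (cylinder U ×ˢ Set.univ) :=
    contDiffOn_fderiv_apply (hZ.prod isOpen_univ) hη _
  set A : (Option (Fin n) → ℝ) → ℝ := fun z => η (z, 1) - η (z, 0)
  have hA : ContDiffOn ℝ ∞ A (cylinder U) := (hηu 1).sub (hηu 0)
  have h_const : ∀ z ∈ cylinder U, ∀ u, fiberDeriv η (z, u) = A z := fun z hz =>
    fiberDeriv_eq_sub_of_fiberDeriv_eq_zero hZ hη hz fun u => (h_det z hz u).1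
  have h_grad : ∀ z ∈ cylinder U, ∀ i, fderiv ℝ A z (Pi.single (some i) 1)
      = -(1 / 2) * deriv T (timeProj n z) * lowered g Y i (spaceProj n z) := fun z hz i => by
    rw [fderiv_congr_of_eqOn hZ (fun y hy => (h_const y hy 0).symm) hz, fderiv_slice hZ h_fiber hz,
      (h_det z hz 0).2.1]
  refine ⟨A, hA, h_grad, fun z hz => ?_⟩
  have h_jet : schrodinger g V (functionJet A z)
      = schrodinger g V (functionJet (fun y => η (y, 1)) z)
        - schrodinger g V (functionJet (fun y => η (y, 0)) z) := by
    rw [functionJet_sub hZ (hηu 1) (hηu 0) hz]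
    exact (isLinearMap_schrodinger g V z).map_sub _ _
  have dT' : Differentiable ℝ fun t => -(1 / 2) * deriv T t :=
    ((contDiff_infty_iff_deriv.1 hT).2.differentiable (by simp)).const_mul _
  have h_one := (h_det z hz 1).2.2
  have h_zero := (h_det z hz 0).2.2
  have h_op := h.schrodinger_functionJet_of_grad (V := V) dT' h_grad hz
  rw [h_const z hz] at h_one h_zero
  linarith

end IsHomotheticOn

theorem IsLieMultiplier.mul_pd_potentialVariation {A : (Option (Fin n) → ℝ) → ℝ}
    (hA : IsLieMultiplier g Y ψ V T U A) (h : IsHomotheticOn g Y ψ U) (hV : ContDiffOn ℝ ∞ V U)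
    (hT : ContDiff ℝ ∞ T) (t : ℝ) {x : Fin n → ℝ} (hx : x ∈ U) (i : Fin n) :
    T t * pd (potentialVariation Y ψ V) i x
      = (1 / 2) * deriv (deriv T) t * lowered g Y i x := by
  have dT : Differentiable ℝ T := hT.differentiable (by simp)
  have dT' : Differentiable ℝ (deriv T) :=
    (contDiff_infty_iff_deriv.1 hT).2.differentiable (by simp)
  have h_symm := mul_pd_eq_deriv_mul_of_fderiv_eq (τ := timeProj n) (π := spaceProj n)
    (T := fun t => -T t) (a := fun t => -(1 / 2) * n * ψ * deriv T t)
    (S := fun t => -(1 / 2) * deriv T t) (w := fun a => a.elim t x) (isOpen_cylinder h.isOpen)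
    hA.smooth dT.neg (dT'.const_mul _) (dT'.const_mul _) hx
    (differentiableAt_of_contDiffOn h.isOpen (h.contDiffOn_potentialVariation hV) hx)
    (differentiableAt_of_contDiffOn h.isOpen (h.smooth_lowered i) hx) timeProj_single_none
    spaceProj_single_none (timeProj_single_some i) (spaceProj_single_some i) hA.time
    fun z hz => hA.grad z hz i
  have h_point : -T t * pd (potentialVariation Y ψ V) i x
      = deriv (fun t => -(1 / 2) * deriv T t) t * lowered g Y i x := h_symm
  rw [deriv_const_mul_field] at h_point
  linarith

end Schrodinger

section Noether

variable {n : ℕ} {g : (Fin n → ℝ) → Matrix (Fin n) (Fin n) ℝ} {Y : Fin n → (Fin n → ℝ) → ℝ}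
  {ψ : ℝ} {U : Set (Fin n → ℝ)} {V : (Fin n → ℝ) → ℝ} {T : ℝ → ℝ} {τ f : ℝ × (Fin n → ℝ) → ℝ}

theorem timeDeriv_eq (F : ℝ × (Fin n → ℝ) → ℝ) (t : ℝ) (x v : Fin n → ℝ) :
    timeDeriv F t x v
      = fderiv ℝ F (t, x) (1, 0) + (fun i => fderiv ℝ F (t, x) (0, Pi.single i 1)) ⬝ᵥ v := by
  have h_split : ((1, v) : ℝ × (Fin n → ℝ)) = (1, 0) + ∑ i, v i • (0, Pi.single i 1) := by
    refine Prod.ext (by simp [Prod.fst_sum]) (funext fun j => ?_)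
    simp [Prod.snd_sum, Pi.single_apply]
  rw [timeDeriv, h_split, map_add, map_sum, dotProduct]
  simp only [map_smul, smul_eq_mul, mul_comm (v _)]

theorem lagrangian_eq (g : (Fin n → ℝ) → Matrix (Fin n) (Fin n) ℝ) (V : (Fin n → ℝ) → ℝ)
    (w : ℝ × (Fin n → ℝ) × (Fin n → ℝ)) :
    lagrangian g V w = (1 / 2) * (w.2.2 ⬝ᵥ (g w.2.1).mulVec w.2.2) - V w.2.1 := by
  simp only [lagrangian, dotProduct, Matrix.mulVec, Finset.mul_sum]
  exact congrArg (· - V w.2.1) <|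
    Finset.sum_congr rfl fun i _ => Finset.sum_congr rfl fun j _ => by ring

theorem IsMetricOn.fderiv_lagrangian (h : IsMetricOn g U) (hV : ContDiffOn ℝ ∞ V U)
    {w : ℝ × (Fin n → ℝ) × (Fin n → ℝ)} (hw : w.2.1 ∈ U) (d : ℝ × (Fin n → ℝ) × (Fin n → ℝ)) :
    fderiv ℝ (lagrangian g V) w d
      = (1 / 2) * (w.2.2 ⬝ᵥ (matrixDeriv g w.2.1 d.2.1).mulVec w.2.2)
        + w.2.2 ⬝ᵥ (g w.2.1).mulVec d.2.2 - fderiv ℝ V w.2.1 d.2.1 := by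
  let π : ℝ × (Fin n → ℝ) × (Fin n → ℝ) →L[ℝ] (Fin n → ℝ) :=
    (ContinuousLinearMap.fst ℝ _ _).comp (ContinuousLinearMap.snd ℝ _ _)
  let ν : ℝ × (Fin n → ℝ) × (Fin n → ℝ) →L[ℝ] (Fin n → ℝ) :=
    (ContinuousLinearMap.snd ℝ _ _).comp (ContinuousLinearMap.snd ℝ _ _)
  have h_metric : ∀ i j, HasFDerivAt (fun w => g (π w) i j) _ w := fun i j =>
    (h.differentiableAt (x := π w) hw i j).hasFDerivAt.comp w π.hasFDerivAt
  have h_vel : ∀ i, HasFDerivAt (fun w => ν w i) _ w := hasFDerivAt_pi'.1 ν.hasFDerivAt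
  have h_potential : HasFDerivAt (fun w => V (π w)) _ w :=
    (differentiableAt_of_contDiffOn h.isOpen hV hw).hasFDerivAt.comp w π.hasFDerivAt
  have h_metric_deriv : matrixDeriv (fun w => g (π w)) w d = matrixDeriv g (π w) (π d) :=
    Matrix.ext fun i j => congrArg (fun φ => φ d) (h_metric i j).fderiv
  have h_vel_deriv : (fun i => fderiv ℝ (fun w => ν w i) w d) = ν d :=
    funext fun i => congrArg (fun φ => φ d) (h_vel i).fderiv
  have h_kinetic := differentiableAt_dotProduct_mulVec
    (fun i j => (h_metric i j).differentiableAt) fun i => (h_vel i).differentiableAt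
  have h_kinetic_deriv := fderiv_dotProduct_mulVec_apply
    (fun i j => (h_metric i j).differentiableAt) (fun i => (h_vel i).differentiableAt)
    (h.isSymm (π w) hw) d
  rw [h_metric_deriv, h_vel_deriv] at h_kinetic_deriv
  have h_eq : lagrangian g V = fun w => (1 / 2) * (ν w ⬝ᵥ (g (π w)).mulVec (ν w)) - V (π w) :=
    funext (lagrangian_eq g V)
  rw [h_eq, fderiv_fun_sub (h_kinetic.const_mul _) h_potential.differentiableAt,
    fderiv_const_mul h_kinetic, h_potential.fderiv, _root_.sub_apply, _root_.smul_apply,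
    h_kinetic_deriv, smul_eq_mul, mul_add, ← mul_assoc, one_div_mul_cancel two_ne_zero, one_mul,
    add_comm]
  rfl

namespace IsHomotheticOn

theorem dotProduct_matrixDeriv_metric_mulVec (h : IsHomotheticOn g Y ψ U) {x : Fin n → ℝ}
    (hx : x ∈ U) (v : Fin n → ℝ) :
    v ⬝ᵥ (matrixDeriv g x fun k => Y k x).mulVec v
      = 2 * ψ * (v ⬝ᵥ (g x).mulVec v) - 2 * (v ⬝ᵥ (g x).mulVec ((jacobian Y x).mulVec v)) := by
  have h_transpose : v ⬝ᵥ ((jacobian Y x).transpose * g x).mulVec v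
      = v ⬝ᵥ (g x).mulVec ((jacobian Y x).mulVec v) := by
    rw [← Matrix.mulVec_mulVec, Matrix.dotProduct_mulVec, Matrix.vecMul_transpose,
      Matrix.dotProduct_mulVec, ← Matrix.mulVec_transpose, (h.isSymm x hx).eq, dotProduct_comm]
  rw [h.matrixDeriv_metric hx, Matrix.sub_mulVec, Matrix.sub_mulVec, dotProduct_sub,
    dotProduct_sub, h_transpose, ← Matrix.mulVec_mulVec, Matrix.smul_mulVec, dotProduct_smul,
    smul_eq_mul]
  ring

theorem prolongLagrangian_add (h : IsHomotheticOn g Y ψ U) (hV : ContDiffOn ℝ ∞ V U)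
    (hT : Differentiable ℝ T) (t : ℝ) {x : Fin n → ℝ} (hx : x ∈ U) (v : Fin n → ℝ) :
    prolongLagrangian τ (fun i w => T w.1 * Y i w.2) (lagrangian g V) t x v
        + timeDeriv τ t x v * lagrangian g V (t, x, v)
      = (ψ * T t - (1 / 2) * timeDeriv τ t x v) * (v ⬝ᵥ (g x).mulVec v)
        + deriv T t * ((fun i => lowered g Y i x) ⬝ᵥ v) - T t * (∑ k, Y k x * pd V k x)
        - timeDeriv τ t x v * V x := by
  have h_velocity : (fun i => timeDeriv (fun w => T w.1 * Y i w.2) t x v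
      - v i * timeDeriv τ t x v) = T t • (jacobian Y x).mulVec v + deriv T t • (fun i => Y i x)
        - timeDeriv τ t x v • v := funext fun i => by
    have h_sep := fderiv_separated (τ := ContinuousLinearMap.fst ℝ ℝ (Fin n → ℝ))
      (π := ContinuousLinearMap.snd ℝ ℝ (Fin n → ℝ)) (w := (t, x)) (hT t)
      (h.differentiableAt_field hx i) (1, v)
    have h_jacobian : fderiv ℝ (Y i) x v = (jacobian Y x).mulVec v i :=
      (fderiv_eq_sum_pd (Y i) x v).trans (dotProduct_comm _ _)
    have h_field : timeDeriv (fun w => T w.1 * Y i w.2) t x v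
        = T t * fderiv ℝ (Y i) x v + Y i x * deriv T t * 1 := h_sep
    simp only [h_field, h_jacobian, Pi.add_apply, Pi.sub_apply, Pi.smul_apply, smul_eq_mul]
    ring
  have h_field : (fun i => T t * Y i x) = T t • fun i => Y i x := rfl
  have h_deriv : matrixDeriv g x (T t • fun i => Y i x) = T t • matrixDeriv g x fun i => Y i x := by
    ext i j
    simp only [matrixDeriv, Matrix.of_apply, map_smul, Matrix.smul_apply]
  rw [prolongLagrangian, h.fderiv_lagrangian hV (w := (t, x, v)) hx, lagrangian_eq]
  simp only [h_velocity, h_field, h_deriv, map_smul, fderiv_eq_sum_pd V x fun i => Y i x,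
    Matrix.smul_mulVec, Matrix.mulVec_sub, Matrix.mulVec_add, Matrix.mulVec_smul, dotProduct_sub,
    dotProduct_add, dotProduct_smul, smul_eq_mul, h.dotProduct_matrixDeriv_metric_mulVec hx]
  have h_lowered : v ⬝ᵥ (g x).mulVec (fun i => Y i x) = (fun i => lowered g Y i x) ⬝ᵥ v :=
    dotProduct_comm _ _
  rw [h_lowered]
  ring

theorem isNoetherPointSymmetryOn (h : IsHomotheticOn g Y ψ U) (hV : ContDiffOn ℝ ∞ V U)
    {c : ℝ} (hc : ∀ x ∈ U, ∀ i, pd (potentialVariation Y ψ V) i x = c * lowered g Y i x)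
    {α : ℝ → ℝ} (hT : ContDiff ℝ ∞ T) (hα : ContDiff ℝ ∞ α) (hα' : ∀ t, deriv α t = -T t)
    (hT' : ∀ t, deriv T t = c * α t) :
    IsNoetherPointSymmetryOn (lagrangian g V) U (fun w => -2 * ψ * α w.1)
      (fun i w => T w.1 * Y i w.2) (fun w => α w.1 * potentialVariation Y ψ V w.2) := by
  have hW := h.contDiffOn_potentialVariation hV
  have h_maps : Set.MapsTo (ContinuousLinearMap.snd ℝ ℝ (Fin n → ℝ)) (Set.univ ×ˢ U) U :=
    fun _ hw => hw.2
  have dα : Differentiable ℝ α := hα.differentiable (by simp)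
  refine ⟨(contDiff_const.mul (hα.comp contDiff_fst)).contDiffOn, fun i =>
    contDiffOn_separated (τ := ContinuousLinearMap.fst ℝ ℝ (Fin n → ℝ)) hT (h.smooth_field i)
      h_maps, contDiffOn_separated (τ := ContinuousLinearMap.fst ℝ ℝ (Fin n → ℝ)) hα hW h_maps,
    fun t x v hx => ?_⟩
  have h_τ : timeDeriv (fun w => -2 * ψ * α w.1) t x v = 2 * ψ * T t := by
    have h_time : timeDeriv (fun w => -2 * ψ * α w.1) t x v
        = deriv (fun t => -2 * ψ * α t) t * 1 :=
      fderiv_comp_time (τ := ContinuousLinearMap.fst ℝ ℝ (Fin n → ℝ)) (w := (t, x))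
        ((dα t).const_mul (-2 * ψ)) (1, v)
    rw [h_time, deriv_const_mul_field, hα']
    ring
  have h_gauge : timeDeriv (fun w => α w.1 * potentialVariation Y ψ V w.2) t x v
      = α t * (c * ((fun i => lowered g Y i x) ⬝ᵥ v)) - T t * potentialVariation Y ψ V x := by
    have h_sep : timeDeriv (fun w => α w.1 * potentialVariation Y ψ V w.2) t x v
        = α t * fderiv ℝ (potentialVariation Y ψ V) x v
          + potentialVariation Y ψ V x * deriv α t * 1 :=
      fderiv_separated (τ := ContinuousLinearMap.fst ℝ ℝ (Fin n → ℝ))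
        (π := ContinuousLinearMap.snd ℝ ℝ (Fin n → ℝ)) (w := (t, x)) (dα t)
        (differentiableAt_of_contDiffOn h.isOpen hW hx) (1, v)
    have h_grad : fderiv ℝ (potentialVariation Y ψ V) x v
        = c * ((fun i => lowered g Y i x) ⬝ᵥ v) := by
      rw [fderiv_eq_sum_pd, dotProduct, Finset.mul_sum]
      refine Finset.sum_congr rfl fun i _ => ?_
      rw [hc x hx]
      ring
    rw [h_sep, h_grad, hα']
    ring
  rw [h.prolongLagrangian_add hV (hT.differentiable (by simp)) t hx, h_τ, h_gauge, hT',
    potentialVariation]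
  ring

theorem noether_determining_equations [Nonempty (Fin n)] (h : IsHomotheticOn g Y ψ U)
    (hV : ContDiffOn ℝ ∞ V U) (hT : Differentiable ℝ T)
    (hN : IsNoetherPointSymmetryOn (lagrangian g V) U τ (fun i w => T w.1 * Y i w.2) f)
    {w : ℝ × (Fin n → ℝ)} (hw : w.2 ∈ U) :
    fderiv ℝ f w (1, 0) = -T w.1 * potentialVariation Y ψ V w.2 ∧
      ∀ i, fderiv ℝ f w (0, Pi.single i 1) = deriv T w.1 * lowered g Y i w.2 := by
  obtain ⟨t, x⟩ := w
  set τx : Fin n → ℝ := fun i => fderiv ℝ τ (t, x) (0, Pi.single i 1)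
  set fx : Fin n → ℝ := fun i => fderiv ℝ f (t, x) (0, Pi.single i 1)
  obtain ⟨hl, ha, hm, hc⟩ := coeffs_eq_zero_of_forall_cubic_dotProduct_eq_zero
    (l := -(1 / 2 : ℝ) • τx) (a := ψ * T t - (1 / 2) * fderiv ℝ τ (t, x) (1, 0))
    (m := deriv T t • (fun i => lowered g Y i x) - V x • τx - fx)
    (c := -T t * (∑ k, Y k x * pd V k x) - V x * fderiv ℝ τ (t, x) (1, 0)
      - fderiv ℝ f (t, x) (1, 0)) (h.isSymm x hw) (h.isUnit_det x hw) fun v => by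
    have hv := hN.2.2.2 t x v hw
    rw [h.prolongLagrangian_add hV hT t hw, timeDeriv_eq, timeDeriv_eq] at hv
    simp only [sub_dotProduct, smul_dotProduct, smul_eq_mul]
    linear_combination hv
  have hτx : τx = 0 := (smul_eq_zero.1 hl).resolve_left (by norm_num)
  refine ⟨?_, fun i => ?_⟩
  · rw [potentialVariation]
    linear_combination -hc + 2 * V x * ha
  · have h_fx : deriv T t * lowered g Y i x - V x * τx i - fx i = 0 := congrFun hm i
    rw [hτx, Pi.zero_apply, mul_zero, sub_zero] at h_fx
    exact (sub_eq_zero.1 h_fx).symm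

theorem mul_pd_potentialVariation_of_noether (h : IsHomotheticOn g Y ψ U)
    (hV : ContDiffOn ℝ ∞ V U) (hT : ContDiff ℝ ∞ T)
    (hN : IsNoetherPointSymmetryOn (lagrangian g V) U τ (fun i w => T w.1 * Y i w.2) f)
    (t : ℝ) {x : Fin n → ℝ} (hx : x ∈ U) (i : Fin n) :
    T t * pd (potentialVariation Y ψ V) i x = -deriv (deriv T) t * lowered g Y i x := by
  have : Nonempty (Fin n) := ⟨i⟩
  have dT : Differentiable ℝ T := hT.differentiable (by simp)
  have dT' : Differentiable ℝ (deriv T) :=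
    (contDiff_infty_iff_deriv.1 hT).2.differentiable (by simp)
  have h_eqs := fun w (hw : w ∈ (Set.univ : Set ℝ) ×ˢ U) =>
    h.noether_determining_equations hV dT hN hw.2
  have h_symm := mul_pd_eq_deriv_mul_of_fderiv_eq
    (τ := ContinuousLinearMap.fst ℝ ℝ (Fin n → ℝ)) (π := ContinuousLinearMap.snd ℝ ℝ (Fin n → ℝ))
    (T := fun t => -T t) (a := fun _ => 0) (w := (t, x)) (i := i) (isOpen_univ.prod h.isOpen)
    hN.2.2.1 dT.neg (differentiable_const 0) dT' ⟨trivial, hx⟩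
    (differentiableAt_of_contDiffOn h.isOpen (h.contDiffOn_potentialVariation hV) hx)
    (differentiableAt_of_contDiffOn h.isOpen (h.smooth_lowered i) hx) (d := (1, 0))
    (v := (0, Pi.single i 1)) rfl rfl rfl rfl
    (fun w hw => (h_eqs w hw).1.trans (add_zero _).symm) fun w hw => (h_eqs w hw).2 i
  have h_point : -T t * pd (potentialVariation Y ψ V) i x
      = deriv (deriv T) t * lowered g Y i x := h_symm
  linarith

end IsHomotheticOn

end Noether

theorem exists_deriv_deriv_eq_mul (k : ℝ) : ∃ α : ℝ → ℝ, ContDiff ℝ ∞ α ∧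
    (∀ t, deriv (deriv α) t = k * α t) ∧ ∃ t, deriv α t ≠ 0 := by
  rcases lt_trichotomy k 0 with hk | rfl | hk
  · obtain ⟨r, hr, rfl⟩ : ∃ r : ℝ, 0 < r ∧ k = -r ^ 2 :=
      ⟨√(-k), Real.sqrt_pos.2 (neg_pos.2 hk), by rw [Real.sq_sqrt (neg_nonneg.2 hk.le), neg_neg]⟩
    have h_sin : deriv (fun t => Real.sin (r * t)) = fun t => r * Real.cos (r * t) :=
      funext fun t => by rw [deriv_comp_mul_left r Real.sin t, Real.deriv_sin, smul_eq_mul]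
    have h_cos : deriv (fun t => Real.cos (r * t)) = fun t => r * -Real.sin (r * t) :=
      funext fun t => by rw [deriv_comp_mul_left r Real.cos t, Real.deriv_cos, smul_eq_mul]
    refine ⟨fun t => Real.sin (r * t), by fun_prop, fun t => ?_, 0, ?_⟩
    · rw [h_sin, deriv_const_mul_field, h_cos]
      ring
    · simp [h_sin, hr.ne']
  · exact ⟨id, contDiff_id, by simp, 0, by simp⟩
  · obtain ⟨r, hr, rfl⟩ : ∃ r : ℝ, 0 < r ∧ k = r ^ 2 :=
      ⟨√k, Real.sqrt_pos.2 hk, (Real.sq_sqrt hk.le).symm⟩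
    have h_exp : deriv (fun t => Real.exp (r * t)) = fun t => r * Real.exp (r * t) :=
      funext fun t => by rw [deriv_comp_mul_left r Real.exp t, Real.deriv_exp, smul_eq_mul]
    refine ⟨fun t => Real.exp (r * t), by fun_prop, fun t => ?_, 0, ?_⟩
    · rw [h_exp, deriv_const_mul_field, h_exp]
      ring
    · simp [h_exp, hr.ne']

section Congruence

variable {ι : Type} [DecidableEq ι]

theorem totalDeriv0_congr {F G : (ι → ℝ) × ℝ → ℝ} {U : Set (ι → ℝ)} (hU : IsOpen U)
    (h : Set.EqOn F G (U ×ˢ Set.univ)) (i : ι) {J : Jet1 ι} (hJ : J.1 ∈ U) :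
    totalDeriv0 F i J = totalDeriv0 G i J := by
  rw [totalDeriv0, fderiv_congr_of_eqOn (hU.prod isOpen_univ) h ⟨hJ, trivial⟩, totalDeriv0]

variable [Fintype ι]

theorem prolong2_congr {ξ : ι → (ι → ℝ) × ℝ → ℝ} {η η' : (ι → ℝ) × ℝ → ℝ} {U : Set (ι → ℝ)}
    (hU : IsOpen U) (h : Set.EqOn η η' (U ×ˢ Set.univ)) (H : Jet2 ι → ℝ) {J : Jet2 ι}
    (hJ : J.1 ∈ U) : prolong2 ξ η H J = prolong2 ξ η' H J := by
  have h_first : ∀ i, Set.EqOn (prolongCoeff1 ξ η i) (prolongCoeff1 ξ η' i) (Prod.fst ⁻¹' U) :=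
    fun i J hJ => by rw [prolongCoeff1, totalDeriv0_congr hU h i hJ, prolongCoeff1]
  have h_second : ∀ i j, prolongCoeff2 ξ η i j J = prolongCoeff2 ξ η' i j J := fun i j => by
    rw [prolongCoeff2, totalDeriv1, fderiv_congr_of_eqOn (w := (J.1, J.2.1, J.2.2.1))
      (hU.preimage continuous_fst) (h_first i) hJ, prolongCoeff2, totalDeriv1]
  have h_first_at := fun i => h_first i (x := (J.1, J.2.1, J.2.2.1)) hJ
  simp only [prolong2, h_second, h_first_at, h (x := (J.1, J.2.1)) ⟨hJ, trivial⟩]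

theorem isLiePointSymmetryOn_congr {H : Jet2 ι → ℝ} {U : Set (ι → ℝ)}
    {ξ : ι → (ι → ℝ) × ℝ → ℝ} {η η' : (ι → ℝ) × ℝ → ℝ} (hL : IsLiePointSymmetryOn H U ξ η)
    (hU : IsOpen U) (h : Set.EqOn η' η (U ×ˢ Set.univ)) : IsLiePointSymmetryOn H U ξ η' := by
  obtain ⟨hξ, hη, μ, hμ⟩ := hL
  exact ⟨hξ, hη.congr h, μ, fun J hJ hs => by rw [prolong2_congr hU h H hJ, hμ J hJ hs]⟩

theorem isNoetherPointSymmetryOn_congr {n : ℕ} {L : ℝ × (Fin n → ℝ) × (Fin n → ℝ) → ℝ}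
    {U : Set (Fin n → ℝ)} {τ : ℝ × (Fin n → ℝ) → ℝ} {η : Fin n → ℝ × (Fin n → ℝ) → ℝ}
    {f f' : ℝ × (Fin n → ℝ) → ℝ} (hN : IsNoetherPointSymmetryOn L U τ η f) (hU : IsOpen U)
    (h : Set.EqOn f' f (Set.univ ×ˢ U)) : IsNoetherPointSymmetryOn L U τ η f' := by
  obtain ⟨hτ, hη, hf, hN⟩ := hN
  refine ⟨hτ, hη, hf.congr h, fun t x v hx => ?_⟩
  rw [hN t x v hx, timeDeriv, timeDeriv,
    fderiv_congr_of_eqOn (isOpen_univ.prod hU) h (w := (t, x)) ⟨trivial, hx⟩]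

end Congruence

section Charts

variable {n : ℕ} {M : Type*} [TopologicalSpace M]
  {e : OpenPartialHomeomorph M (EuclideanSpace ℝ (Fin n))} {x : Fin n → ℝ}

theorem isOpen_coordRange (e : OpenPartialHomeomorph M (EuclideanSpace ℝ (Fin n))) :
    IsOpen (coordRange e) :=
  e.open_target.preimage (PiLp.continuous_toLp 2 _)

theorem coordPoint_mem_source (hx : x ∈ coordRange e) : coordPoint e x ∈ e.source :=
  e.map_target hx

variable [ChartedSpace (EuclideanSpace ℝ (Fin n)) M]

/-- The components of the vector field `Y` in the chart `e`, as functions of the coordinates. -/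
def coordField (e : OpenPartialHomeomorph M (EuclideanSpace ℝ (Fin n)))
    (Y : ∀ x : M, TangentSpace (𝓡 n) x) (i : Fin n) (x : Fin n → ℝ) : ℝ :=
  coordComp e x (Y (coordPoint e x)) i

theorem coordComp_smul (x : Fin n → ℝ) (s : ℝ) (v : TangentSpace (𝓡 n) (coordPoint e x))
    (i : Fin n) : coordComp e x (s • v) i = s * coordComp e x v i := by
  rw [coordComp, map_smul]
  rfl

theorem mdifferentiable_of_mem_maximalAtlas (he : e ∈ IsManifold.maximalAtlas (𝓡 n) ∞ M) :
    e.MDifferentiable (𝓡 n) (𝓡 n) :=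
  ⟨(contMDiffOn_of_mem_maximalAtlas he).mdifferentiableOn (by simp),
    (contMDiffOn_symm_of_mem_maximalAtlas he).mdifferentiableOn (by simp)⟩

theorem contDiffOn_coordPoint {F : M → ℝ} (hF : ContMDiff (𝓡 n) 𝓘(ℝ, ℝ) ∞ F)
    (he : e ∈ IsManifold.maximalAtlas (𝓡 n) ∞ M) :
    ContDiffOn ℝ ∞ (fun x => F (coordPoint e x)) (coordRange e) :=
  (hF.comp_contMDiffOn (contMDiffOn_symm_of_mem_maximalAtlas he)).contDiffOn.comp
    (PiLp.contDiff_toLp (𝕜 := ℝ)).contDiffOn fun _ hx => hx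

theorem Metric.val_coordVec_sum (g : Metric n M)
    (e : OpenPartialHomeomorph M (EuclideanSpace ℝ (Fin n))) (x w : Fin n → ℝ) (i : Fin n) :
    g.val (coordPoint e x) (coordVec e x i) (∑ j, w j • coordVec e x j)
      = (g.comp e x).mulVec w i := by
  rw [map_sum, Matrix.mulVec, dotProduct]
  exact Finset.sum_congr rfl fun j _ => by
    rw [map_smul, smul_eq_mul, mul_comm, Metric.comp, Matrix.of_apply]

theorem mfderiv_coordVec (he : e ∈ IsManifold.maximalAtlas (𝓡 n) ∞ M) (hx : x ∈ coordRange e)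
    (i : Fin n) :
    (show EuclideanSpace ℝ (Fin n) from
      mfderiv (𝓡 n) (𝓡 n) e (coordPoint e x) (coordVec e x i)) = EuclideanSpace.single i (1 : ℝ) :=
  congrArg (fun φ => φ (EuclideanSpace.single i (1 : ℝ)))
    ((mdifferentiable_of_mem_maximalAtlas he).comp_symm_deriv hx)

theorem sum_coordComp_smul_coordVec (he : e ∈ IsManifold.maximalAtlas (𝓡 n) ∞ M)
    (hx : x ∈ coordRange e) (v : TangentSpace (𝓡 n) (coordPoint e x)) :
    ∑ i, coordComp e x v i • coordVec e x i = v := by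
  apply (mdifferentiable_of_mem_maximalAtlas he).mfderiv_injective (coordPoint_mem_source hx)
  rw [map_sum]
  refine Eq.trans (Finset.sum_congr rfl fun i _ => ?_)
    ((EuclideanSpace.basisFun (Fin n) ℝ).sum_repr _)
  rw [map_smul]
  exact congrArg (coordComp e x v i • ·)
    ((mfderiv_coordVec he hx i).trans (EuclideanSpace.basisFun_apply _ _ i).symm)

theorem coordComp_sum_smul_coordVec (he : e ∈ IsManifold.maximalAtlas (𝓡 n) ∞ M)
    (hx : x ∈ coordRange e) (w : Fin n → ℝ) (i : Fin n) :
    coordComp e x (∑ j, w j • coordVec e x j) i = w i := by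
  have h_map : (show EuclideanSpace ℝ (Fin n) from mfderiv (𝓡 n) (𝓡 n) e (coordPoint e x)
      (∑ j, w j • coordVec e x j)) = ∑ j, w j • EuclideanSpace.single j (1 : ℝ) := by
    rw [map_sum]
    refine Finset.sum_congr rfl fun j _ => ?_
    rw [map_smul]
    exact congrArg (w j • ·) (mfderiv_coordVec he hx j)
  rw [coordComp, h_map]
  simp [Pi.single_apply]

theorem Metric.isUnit_det_comp (g : Metric n M) (he : e ∈ IsManifold.maximalAtlas (𝓡 n) ∞ M)
    (hx : x ∈ coordRange e) : IsUnit (g.comp e x).det := by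
  rw [isUnit_iff_ne_zero]
  intro h_det
  obtain ⟨w, hw, h_kernel⟩ := Matrix.exists_mulVec_eq_zero_iff.2 h_det
  have h_orthogonal : ∀ u, g.val (coordPoint e x) (∑ j, w j • coordVec e x j) u = 0 := fun u => by
    rw [g.symm, ← sum_coordComp_smul_coordVec he hx u, map_sum (g.val _), LinearMap.sum_apply]
    refine Finset.sum_eq_zero fun i _ => ?_
    rw [map_smul, LinearMap.smul_apply, g.val_coordVec_sum, h_kernel, Pi.zero_apply, smul_zero]
  have h_zero := g.nondegenerate _ _ h_orthogonal
  refine hw (funext fun i => ?_)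
  rw [← coordComp_sum_smul_coordVec he hx w i, h_zero, coordComp, map_zero]
  rfl

theorem pd_coordPoint {F : M → ℝ} (hF : ContMDiff (𝓡 n) 𝓘(ℝ, ℝ) ∞ F)
    (he : e ∈ IsManifold.maximalAtlas (𝓡 n) ∞ M) (hx : x ∈ coordRange e) (i : Fin n) :
    pd (fun x => F (coordPoint e x)) i x
      = (show ℝ from mfderiv (𝓡 n) 𝓘(ℝ, ℝ) F (coordPoint e x) (coordVec e x i)) := by
  have hF_at : MDifferentiableAt (𝓡 n) 𝓘(ℝ, ℝ) F (coordPoint e x) :=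
    hF.mdifferentiable (by simp) _
  have he_symm := (mdifferentiable_of_mem_maximalAtlas he).mdifferentiableAt_symm hx
  have h_chain := mfderiv_comp (WithLp.toLp 2 x) hF_at he_symm
  rw [mfderiv_eq_fderiv] at h_chain
  have h_local : DifferentiableAt ℝ (F ∘ e.symm) (WithLp.toLp 2 x) :=
    (MDifferentiableAt.comp (WithLp.toLp 2 x) hF_at he_symm).differentiableAt
  have h_coord := h_local.hasFDerivAt.comp x
    (PiLp.continuousLinearEquiv 2 ℝ fun _ : Fin n => ℝ).symm.hasFDerivAt
  exact (congrArg (fun φ => φ (Pi.single i 1)) h_coord.fderiv).trans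
    (congrArg (fun φ => φ (EuclideanSpace.single i (1 : ℝ))) h_chain)

variable [IsManifold (𝓡 n) ∞ M]

theorem contDiffOn_coordField {Y : ∀ x : M, TangentSpace (𝓡 n) x}
    (hY : ContMDiff (𝓡 n) (𝓡 n).tangent ∞ (fun x => (⟨x, Y x⟩ : TangentBundle (𝓡 n) M)))
    (he : e ∈ IsManifold.maximalAtlas (𝓡 n) ∞ M) (i : Fin n) :
    ContDiffOn ℝ ∞ (coordField e Y i) (coordRange e) := by
  have h_tangentMap := (contMDiffOn_of_mem_maximalAtlas he).contMDiffOn_tangentMapWithin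
    (m := ∞) (by simp) e.open_source.uniqueMDiffOn
  have h_pushforward : ContMDiffOn (𝓡 n) (𝓡 n).tangent ∞
      (fun p => tangentMapWithin (𝓡 n) (𝓡 n) e e.source ⟨p, Y p⟩) e.source :=
    h_tangentMap.comp hY.contMDiffOn fun p hp => hp
  have h_snd := (contMDiff_snd_tangentBundle_modelSpace (EuclideanSpace ℝ (Fin n))
    (𝓡 n) (n := ∞)).comp_contMDiffOn h_pushforward
  have h_target := (h_snd.comp (contMDiffOn_symm_of_mem_maximalAtlas he)
    fun y hy => e.map_target hy).contDiffOn
  have h_coord := h_target.comp (PiLp.contDiff_toLp (𝕜 := ℝ)).contDiffOn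
    fun (x : Fin n → ℝ) (hx : x ∈ coordRange e) => hx
  have h_comp : ContDiffOn ℝ ∞ (fun x => _) (coordRange e) :=
    (EuclideanSpace.proj i : EuclideanSpace ℝ (Fin n) →L[ℝ] ℝ).contDiff.comp_contDiffOn h_coord
  refine h_comp.congr fun x hx => ?_
  have h_mfderiv := mfderivWithin_of_isOpen (I := 𝓡 n) (I' := 𝓡 n) (f := e) e.open_source
    (coordPoint_mem_source hx)
  exact congrArg (fun φ => (show EuclideanSpace ℝ (Fin n) from φ (Y (coordPoint e x))) i)
    h_mfderiv.symm

end Charts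

section Main

variable {n : ℕ} {M : Type*} [TopologicalSpace M] [ChartedSpace (EuclideanSpace ℝ (Fin n)) M]
  {g : Metric n M} {V : M → ℝ} {Y : ∀ x : M, TangentSpace (𝓡 n) x} {ψ : ℝ}
  {e : OpenPartialHomeomorph M (EuclideanSpace ℝ (Fin n))}

/-- The function `Y(V) + 2 ψ V` on `M`. -/
def globalVariation (V : M → ℝ) (Y : ∀ x : M, TangentSpace (𝓡 n) x) (ψ : ℝ) (p : M) : ℝ :=
  (show ℝ from mfderiv (𝓡 n) 𝓘(ℝ, ℝ) V p (Y p)) + 2 * ψ * V p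

/-- In every chart, the differential of `Y(V) + 2 ψ V` is `c` times the metric dual of `Y`. -/
def HasVariationFactor (g : Metric n M) (V : M → ℝ) (Y : ∀ x : M, TangentSpace (𝓡 n) x)
    (ψ c : ℝ) : Prop :=
  ∀ e ∈ IsManifold.maximalAtlas (𝓡 n) ∞ M, ∀ x ∈ coordRange e, ∀ i : Fin n,
    pd (potentialVariation (coordField e Y) ψ fun y => V (coordPoint e y)) i x
      = c * lowered (g.comp e) (coordField e Y) i x

theorem isLiePointSymmetry_iff {T : ℝ → ℝ} {ξ η : ℝ × M × ℝ → ℝ} :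
    IsLiePointSymmetry g V ξ (fun w => T w.1 • Y w.2.1) η
      ↔ ∀ e ∈ IsManifold.maximalAtlas (𝓡 n) ∞ M,
        IsLiePointSymmetryOn (schrodinger (g.comp e) fun x => V (coordPoint e x))
          (cylinder (coordRange e))
          (liftedField (fun w => ξ (timeProj n w.1, coordPoint e (spaceProj n w.1), w.2)) T
            (coordField e Y))
          (fun w => η (timeProj n w.1, coordPoint e (spaceProj n w.1), w.2)) := by
  refine forall₂_congr fun e _ => iff_of_eq (congrArg (IsLiePointSymmetryOn _ _ · _) ?_)
  funext a w
  cases a with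
  | none => rfl
  | some i => exact coordComp_smul _ _ _ _

theorem isNoetherPointSymmetry_iff {T : ℝ → ℝ} {τ : ℝ × M → ℝ} :
    IsNoetherPointSymmetry g V τ (fun w => T w.1 • Y w.2)
      ↔ ∃ f : ℝ × M → ℝ, ∀ e ∈ IsManifold.maximalAtlas (𝓡 n) ∞ M,
        IsNoetherPointSymmetryOn (lagrangian (g.comp e) fun x => V (coordPoint e x))
          (coordRange e) (fun w => τ (w.1, coordPoint e w.2))
          (fun i w => T w.1 * coordField e Y i w.2) (fun w => f (w.1, coordPoint e w.2)) := by
  simp only [IsNoetherPointSymmetry, coordComp_smul]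
  rfl

theorem globalVariation_coordPoint (hV : ContMDiff (𝓡 n) 𝓘(ℝ, ℝ) ∞ V)
    (he : e ∈ IsManifold.maximalAtlas (𝓡 n) ∞ M) {x : Fin n → ℝ} (hx : x ∈ coordRange e) :
    globalVariation V Y ψ (coordPoint e x)
      = potentialVariation (coordField e Y) ψ (fun y => V (coordPoint e y)) x := by
  have h_field : (show ℝ from mfderiv (𝓡 n) 𝓘(ℝ, ℝ) V (coordPoint e x) (Y (coordPoint e x)))
      = ∑ k, coordField e Y k x * pd (fun y => V (coordPoint e y)) k x := by
    conv_lhs => rw [← sum_coordComp_smul_coordVec he hx (Y (coordPoint e x))]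
    rw [map_sum]
    refine Finset.sum_congr rfl fun k _ => ?_
    rw [map_smul, pd_coordPoint hV he hx]
    rfl
  rw [globalVariation, potentialVariation, h_field]

variable [IsManifold (𝓡 n) ∞ M]

namespace HasHomotheticFactor

theorem isHomotheticOn (h : HasHomotheticFactor g Y ψ)
    (hY : ContMDiff (𝓡 n) (𝓡 n).tangent ∞ (fun x => (⟨x, Y x⟩ : TangentBundle (𝓡 n) M)))
    (he : e ∈ IsManifold.maximalAtlas (𝓡 n) ∞ M) :
    IsHomotheticOn (g.comp e) (coordField e Y) ψ (coordRange e) where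
  isOpen := isOpen_coordRange e
  smooth := g.smooth e he
  isSymm _ _ := Matrix.ext fun _ _ => g.symm _ _ _
  isUnit_det _ hx := g.isUnit_det_comp he hx
  smooth_field := contDiffOn_coordField hY he
  lieDeriv := h e he

theorem producesLiePointSymmetry_iff (h : HasHomotheticFactor g Y ψ)
    (hV : ContMDiff (𝓡 n) 𝓘(ℝ, ℝ) ∞ V)
    (hY : ContMDiff (𝓡 n) (𝓡 n).tangent ∞ (fun x => (⟨x, Y x⟩ : TangentBundle (𝓡 n) M))) :
    ProducesLiePointSymmetry g V Y ↔ ∃ c, HasVariationFactor g V Y ψ c := by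
  constructor
  · rintro ⟨T, hT, ⟨t, ht⟩, ξ, η, hL⟩
    refine ⟨deriv (deriv T) t / (2 * T t), fun e he x hx i => ?_⟩
    have : Nonempty (Fin n) := ⟨i⟩
    have h_on := h.isHomotheticOn hY he
    have hV_on := contDiffOn_coordPoint hV he
    obtain ⟨A, hA⟩ := h_on.exists_isLieMultiplier hV_on hT (isLiePointSymmetry_iff.1 hL e he)
    have h_eq := hA.mul_pd_potentialVariation h_on hV_on hT t hx i
    rw [div_mul_eq_mul_div, eq_div_iff (mul_ne_zero two_ne_zero ht)]
    linear_combination 2 * h_eq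
  · rintro ⟨c, hc⟩
    obtain ⟨α, hα, hα'', h_ne⟩ := exists_deriv_deriv_eq_mul (2 * c)
    have hα' := (contDiff_infty_iff_deriv.1 hα).2
    refine ⟨fun t => -deriv α t, hα'.neg, h_ne.imp fun _ => neg_ne_zero.2,
      fun w => -2 * ψ * α w.1, fun w => (α w.1 * globalVariation V Y ψ w.2.1
        + -(1 / 2) * n * ψ * -deriv α w.1) * w.2.2,
      (isLiePointSymmetry_iff (Y := Y) (T := fun t => -deriv α t)).2 fun e he => ?_⟩
    refine isLiePointSymmetryOn_congr ((h.isHomotheticOn hY he).isLiePointSymmetryOn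
      (contDiffOn_coordPoint hV he) (hc e he) hα'.neg hα (fun t => (neg_neg _).symm) fun t => ?_)
      (isOpen_cylinder (isOpen_coordRange e)) fun w hw => ?_
    · rw [deriv.fun_neg, hα'']
      ring
    · simp only [globalVariation_coordPoint hV he hw.1]

theorem generatesNoetherPointSymmetry_iff (h : HasHomotheticFactor g Y ψ)
    (hV : ContMDiff (𝓡 n) 𝓘(ℝ, ℝ) ∞ V)
    (hY : ContMDiff (𝓡 n) (𝓡 n).tangent ∞ (fun x => (⟨x, Y x⟩ : TangentBundle (𝓡 n) M))) :
    GeneratesNoetherPointSymmetry g V Y ↔ ∃ c, HasVariationFactor g V Y ψ c := by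
  constructor
  · rintro ⟨T, hT, ⟨t, ht⟩, τ, hN⟩
    obtain ⟨f, hf⟩ := isNoetherPointSymmetry_iff.1 hN
    refine ⟨-deriv (deriv T) t / T t, fun e he x hx i => ?_⟩
    have h_eq := (h.isHomotheticOn hY he).mul_pd_potentialVariation_of_noether
      (contDiffOn_coordPoint hV he) hT (hf e he) t hx i
    rw [div_mul_eq_mul_div, eq_div_iff ht, mul_comm, h_eq]
  · rintro ⟨c, hc⟩
    obtain ⟨α, hα, hα'', h_ne⟩ := exists_deriv_deriv_eq_mul (-c)
    have hα' := (contDiff_infty_iff_deriv.1 hα).2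
    refine ⟨fun t => -deriv α t, hα'.neg, h_ne.imp fun _ => neg_ne_zero.2,
      fun w => -2 * ψ * α w.1, (isNoetherPointSymmetry_iff (Y := Y) (T := fun t => -deriv α t)).2
        ⟨fun w => α w.1 * globalVariation V Y ψ w.2, fun e he => ?_⟩⟩
    refine isNoetherPointSymmetryOn_congr ((h.isHomotheticOn hY he).isNoetherPointSymmetryOn
      (contDiffOn_coordPoint hV he) (hc e he) hα'.neg hα (fun t => (neg_neg _).symm) fun t => ?_)
      (isOpen_coordRange e) fun w hw => ?_
    · rw [deriv.fun_neg, hα'']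
      ring
    · simp only [globalVariation_coordPoint hV he hw.2]

end HasHomotheticFactor

end Main

end PointSym

end

theorem proposition3 {n : ℕ} {M : Type*} [TopologicalSpace M]
    [ChartedSpace (EuclideanSpace ℝ (Fin n)) M] [IsManifold (𝓡 n) ∞ M]
    (g : PointSym.Metric n M) (V : M → ℝ) (hV : ContMDiff (𝓡 n) 𝓘(ℝ, ℝ) ∞ V)
    (Y : ∀ x : M, TangentSpace (𝓡 n) x)
    (hY : ContMDiff (𝓡 n) (𝓡 n).tangent ∞ (fun x => (⟨x, Y x⟩ : TangentBundle (𝓡 n) M)))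
    (hH : PointSym.IsKilling g Y ∨ PointSym.IsHomothetic g Y) :
    PointSym.ProducesLiePointSymmetry g V Y ↔ PointSym.GeneratesNoetherPointSymmetry g V Y := by
  obtain ⟨ψ, h⟩ : PointSym.IsHomothetic g Y := hH.elim (fun h => ⟨0, h⟩) id
  exact (h.producesLiePointSymmetry_iff hV hY).trans
    (h.generatesNoetherPointSymmetry_iff hV hY).symm
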